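/- Let $b\ge 1$, let $V_0$ be a complex vector space of dimension $b+1$, $S=\mathrm{Sym}^\bullet(V_0)$ and $m=(V_0)\subset S$ its irrelevant ideal. Exterior comultiplication is normalized by $w_0\wedge\dots\wedge w_n\mapsto\sum_j(-1)^j\,w_j\otimes(w_0\wedge\dots\widehat{w_j}\dots\wedge w_n)$, and $\wedge^2V_0\subset V_0\otimes V_0$ is the inclusion $u\wedge v\mapsto u\otimes v-v\otimes u$. Put $\mathrm{Sym}^jV_0=0$ for $j<0$. Let $\varphi:S\otimes\wedge^2V_0\to S\otimes V_0$, $1\otimes(u\wedge v)\mapsto u\otimes v-v\otimes u$, be the Koszul differential. For a subspace $V_1\subset\wedge^2V_0$, let $\mathrm{Sym}^{b-1}(\varphi|_{V_1\otimes S})$ be the complex of free $S$-modules with terms $S\otimes\wedge^iV_1\otimes\mathrm{Sym}^{b-1-i}V_0$ ($i\ge 0$), whose differential is comultiplication on the exterior algebra, followed by $\varphi$, followed by multiplication on the symmetric algebra. For $n,i\ge0$ let $$\mathbb S_{(n,1^i)}V_0=\ker\bigl(\wedge^iV_0\otimes\mathrm{Sym}^nV_0\xrightarrow{\ \delta\ }\wedge^{i-1}V_0\otimes\mathrm{Sym}^{n+1}V_0\bigr),$$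 where $\delta$ is comultiplication followed by multiplication (and $\wedge^{-1}V_0=0$). Let $C_\bullet$ be the complex with terms $C_i=S\otimes\mathbb S_{(b-1,1^i)}V_0$, whose differential is induced by comultiplication on $\wedge^\bullet V_0$ followed by multiplication into $S$. Finally let $\psi_{i,j}(\wedge^2V_0):\wedge^i(\wedge^2V_0)\otimes\mathrm{Sym}^jV_0\to\mathbb S_{(i+j,1^i)}V_0$ be given by the composition $$\wedge^i(\wedge^2V_0)\otimes\mathrm{Sym}^jV_0\to\wedge^i(V_0\otimes V_0)\otimes\mathrm{Sym}^jV_0\to\wedge^iV_0\otimes\mathrm{Sym}^iV_0\otimes\mathrm{Sym}^jV_0\to\wedge^iV_0\otimes\mathrm{Sym}^{i+j}V_0,$$ which takes values in $\mathbb S_{(i+j,1^i)}V_0$ (the middle map is $(v_1\otimes u_1)\wedge\dots\wedge(v_i\otimes u_i)\mapsto(v_1\wedge\dots\wedge v_i)\otimes u_1\cdots u_i$), and let $\psi_{i,j}(V_1)$ be its restriction to $\wedge^iV_1\otimes\mathrm{Sym}^jV_0$. Then: 1. $C_\bullet$, with the augmentation $S\otimes\mathrm{Sym}^{b-1}V_0\to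 S$ given by multiplication, is a minimal free resolution of $m^{b-1}$ by free modules of finite rank, and its differentials and augmentation are $GL(V_0)$-equivariant. 2. For $0\le i\le b-1$ the map $\psi_{i,b-1-i}(\wedge^2V_0)$ is surjective and $GL(V_0)$-equivariant. 3. For every subspace $V_1\subset\wedge^2V_0$, the $S$-linear extensions of the maps $$f(V_1)_i=\psi_{i,b-1-i}(V_1):\wedge^iV_1\otimes\mathrm{Sym}^{b-1-i}V_0\to\mathbb S_{(b-1,1^i)}V_0\qquad(i\ge0)$$ form a chain map $f(V_1)_\bullet:\mathrm{Sym}^{b-1}(\varphi|_{V_1\otimes S})\to C_\bullet$. -/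

import Mathlib

open scoped TensorProduct
noncomputable section
universe u
namespace HookResolution

/-- The component `⋀ⁿ⁺¹W → W ⊗ ⋀ⁿW` of the comultiplication of the exterior algebra, in all degrees
at once: `w₀ ∧ ⋯ ∧ wₙ ↦ ∑ⱼ (-1)ʲ wⱼ ⊗ (w₀ ∧ ⋯ ŵⱼ ⋯ ∧ wₙ)`, and `1 ↦ 0`; see `comul_ιMulti`. -/
def comul (W : Type*) [AddCommGroup W] [Module ℂ W] :
    ExteriorAlgebra ℂ W →ₗ[ℂ] W ⊗[ℂ] ExteriorAlgebra ℂ W :=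
  ExteriorAlgebra.liftAlternating fun
    | 0 => 0
    | n + 1 => AlternatingMap.alternatizeUncurryFin
        { toFun := fun w =>
            (TensorProduct.mk ℂ W (ExteriorAlgebra ℂ W) w).compAlternatingMap
              (ExteriorAlgebra.ιMulti ℂ n)
          map_add' := by intro a b; ext v; simp
          map_smul' := by intro c a; ext v; simp [TensorProduct.smul_tmul'] }

theorem comul_ιMulti (W : Type*) [AddCommGroup W] [Module ℂ W] {n : ℕ} (w : Fin (n + 1) → W) :
    comul W (ExteriorAlgebra.ιMulti ℂ (n + 1) w) =
      ∑ j : Fin (n + 1), (-1 : ℤ) ^ (j : ℕ) •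
        (w j ⊗ₜ[ℂ] ExteriorAlgebra.ιMulti ℂ n (j.removeNth w)) := by
  rw [comul, ExteriorAlgebra.liftAlternating_apply_ιMulti,
    AlternatingMap.alternatizeUncurryFin_apply]
  rfl

theorem comul_one (W : Type*) [AddCommGroup W] [Module ℂ W] : comul W 1 = 0 := by
  rw [comul, ExteriorAlgebra.liftAlternating_one]
  rfl

theorem comul_ι_mul (W : Type*) [AddCommGroup W] [Module ℂ W] (w : W) (x : ExteriorAlgebra ℂ W) :
    comul W (ExteriorAlgebra.ι ℂ w * x) = w ⊗ₜ[ℂ] x -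
      (LinearMap.mulLeft ℂ (ExteriorAlgebra.ι ℂ w)).lTensor W (comul W x) := by
  have key : comul W ∘ₗ LinearMap.mulLeft ℂ (ExteriorAlgebra.ι ℂ w) =
      TensorProduct.mk ℂ W (ExteriorAlgebra ℂ W) w -
        (LinearMap.mulLeft ℂ (ExteriorAlgebra.ι ℂ w)).lTensor W ∘ₗ comul W := by
    apply ExteriorAlgebra.lhom_ext
    intro n
    ext v
    have h1 : ExteriorAlgebra.ι ℂ w * ExteriorAlgebra.ιMulti ℂ n v =
        ExteriorAlgebra.ιMulti ℂ (n + 1) (Matrix.vecCons w v) := by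
      rw [ExteriorAlgebra.ιMulti_succ_apply]; simp
    simp only [LinearMap.compAlternatingMap_apply, LinearMap.comp_apply, LinearMap.mulLeft_apply,
      LinearMap.sub_apply, TensorProduct.mk_apply]
    rw [h1, comul_ιMulti, Fin.sum_univ_succ]
    simp only [Fin.val_zero, pow_zero, one_smul, Matrix.cons_val_zero, Matrix.cons_val_succ]
    rw [sub_eq_add_neg]
    congr 1
    cases n with
    | zero => rw [ExteriorAlgebra.ιMulti_zero_apply, comul_one]; simp
    | succ n =>
      rw [comul_ιMulti, map_sum, ← Finset.sum_neg_distrib]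
      refine Finset.sum_congr rfl fun j _ => ?_
      rw [map_zsmul, LinearMap.lTensor_tmul, LinearMap.mulLeft_apply, ← neg_smul, Fin.val_succ,
        pow_succ, mul_neg_one]
      congr 2
      have e : j.succ.removeNth (Matrix.vecCons w v) = Matrix.vecCons w (j.removeNth v) := by
        ext k
        refine Fin.cases ?_ (fun k => ?_) k
        · rfl
        · simp [Fin.removeNth]
      rw [e, ExteriorAlgebra.ιMulti_succ_apply]
      simp
  exact LinearMap.congr_fun key x

/-- The inclusion `⋀²V ⊂ V ⊗ V`, `u ∧ v ↦ u ⊗ v - v ⊗ u`. -/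
def wedgeIncl (V : Type*) [AddCommGroup V] [Module ℂ V] : ⋀[ℂ]^2 V →ₗ[ℂ] V ⊗[ℂ] V :=
  exteriorPower.alternatingMapLinearEquiv (R := ℂ) (M := V) (N := V ⊗[ℂ] V) (n := 2)
    { toFun := fun v => v 0 ⊗ₜ[ℂ] v 1 - v 1 ⊗ₜ[ℂ] v 0
      map_update_add' := by
        intro _ v i x y
        fin_cases i <;> simp [TensorProduct.add_tmul, TensorProduct.tmul_add] <;> abel
      map_update_smul' := by
        intro _ v i c x
        fin_cases i <;> simp [TensorProduct.smul_tmul', smul_sub]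
      map_eq_zero_of_eq' := by
        intro v i j h hij
        fin_cases i <;> fin_cases j <;> simp_all }

theorem wedgeIncl_apply (V : Type*) [AddCommGroup V] [Module ℂ V] (v : Fin 2 → V) :
    wedgeIncl V (exteriorPower.ιMulti ℂ 2 v) = v 0 ⊗ₜ[ℂ] v 1 - v 1 ⊗ₜ[ℂ] v 0 := by
  simp [wedgeIncl]

/-- The Koszul differential of a linear form `g : W → T` with values in a commutative `ℂ`-algebra:
comultiplication on the exterior algebra, followed by `g` and multiplication in `T`, i.e.
`t ⊗ (w₀ ∧ ⋯ ∧ wₙ) ↦ ∑ⱼ (-1)ʲ t g(wⱼ) ⊗ (w₀ ∧ ⋯ ŵⱼ ⋯ ∧ wₙ)`. -/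
def koszul {T W : Type*} [CommRing T] [Algebra ℂ T] [AddCommGroup W] [Module ℂ W]
    (g : W →ₗ[ℂ] T) : (T ⊗[ℂ] ExteriorAlgebra ℂ W) →ₗ[T] (T ⊗[ℂ] ExteriorAlgebra ℂ W) :=
  LinearMap.liftBaseChange T (g.rTensor (ExteriorAlgebra ℂ W) ∘ₗ comul W)

section lemmas
variable {T W : Type*} [CommRing T] [Algebra ℂ T] [AddCommGroup W] [Module ℂ W]
    (g h : W →ₗ[ℂ] T)

theorem koszul_tmul_one (t : T) : koszul g (t ⊗ₜ 1) = 0 := by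
  simp [koszul, comul_one]

theorem koszul_ι_mul (w : W) (y : T ⊗[ℂ] ExteriorAlgebra ℂ W) :
    koszul g ((1 ⊗ₜ[ℂ] ExteriorAlgebra.ι ℂ w) * y) =
      g w • y - (1 ⊗ₜ[ℂ] ExteriorAlgebra.ι ℂ w) * koszul g y := by
  induction y with
  | zero => simp
  | add a b ha hb => rw [mul_add, map_add, map_add, ha, hb, smul_add, mul_add]; abel
  | tmul t x =>
    simp only [koszul, Algebra.TensorProduct.tmul_mul_tmul, one_mul, LinearMap.liftBaseChange_tmul,
      LinearMap.comp_apply, comul_ι_mul, map_sub, smul_sub]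
    congr 1
    · simp [TensorProduct.smul_tmul', mul_comm]
    · generalize comul W x = z
      induction z with
      | zero => simp
      | add a b ha hb => simp only [map_add, smul_add, mul_add, ha, hb]
      | tmul a b => simp [TensorProduct.smul_tmul']

theorem koszul_anticomm (y : T ⊗[ℂ] ExteriorAlgebra ℂ W) :
    koszul g (koszul h y) = - koszul h (koszul g y) := by
  induction y with
  | zero => simp
  | add a b ha hb => simp only [map_add, ha, hb, neg_add]
  | tmul t x =>
    have : t ⊗ₜ[ℂ] x = t • ((1 : T) ⊗ₜ[ℂ] x) := by simp [TensorProduct.smul_tmul']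
    rw [this]
    clear this
    simp only [map_smul, ← smul_neg]
    congr 1
    induction x using CliffordAlgebra.left_induction with
    | algebraMap r =>
      have : (1 : T) ⊗ₜ[ℂ] (algebraMap ℂ (CliffordAlgebra (0 : QuadraticForm ℂ W)) r) =
        (algebraMap ℂ T r) ⊗ₜ[ℂ] (1 : ExteriorAlgebra ℂ W) := by
        rw [Algebra.algebraMap_eq_smul_one, Algebra.algebraMap_eq_smul_one, TensorProduct.smul_tmul]
      rw [this, koszul_tmul_one, koszul_tmul_one]; simp
    | add x y hx hy => simp only [TensorProduct.tmul_add, map_add, hx, hy, neg_add]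
    | ι_mul x m hx =>
      have : (1 : T) ⊗ₜ[ℂ] ((CliffordAlgebra.ι (0 : QuadraticForm ℂ W)) m * x) =
        (1 ⊗ₜ[ℂ] ExteriorAlgebra.ι ℂ m) * ((1 : T) ⊗ₜ[ℂ] x) := by
        simp [ExteriorAlgebra.ι]
      rw [this]
      simp only [koszul_ι_mul, map_sub, map_smul]
      rw [hx]
      simp only [mul_neg]
      abel

theorem koszul_koszul (y : T ⊗[ℂ] ExteriorAlgebra ℂ W) : koszul g (koszul g y) = 0 := by
  have := koszul_anticomm g g y
  have h2 : (2 : ℂ) • koszul g (koszul g y) = 0 := by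
    rw [two_smul]; nth_rw 1 [this]; simp
  simpa using h2
end lemmas

/-- The symmetric power `Symᵐ V`, as the degree `m` part of the symmetric algebra;
it is `0` for `m < 0`. -/
def symPow (V : Type*) [AddCommGroup V] [Module ℂ V] (m : ℤ) :
    Submodule ℂ (SymmetricAlgebra ℂ V) :=
  if 0 ≤ m then (LinearMap.range (SymmetricAlgebra.ι ℂ V)) ^ m.toNat else ⊥

section
variable (W V : Type*) [AddCommGroup W] [Module ℂ W] [AddCommGroup V] [Module ℂ V]

theorem mul_mem_symPow {m : ℤ} {r : ℕ} {x y : SymmetricAlgebra ℂ V} (hx : x ∈ symPow V m)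
    (hy : y ∈ symPow V r) : x * y ∈ symPow V (m + r) := by
  unfold symPow at *
  rw [if_pos (by positivity)] at hy
  split_ifs at hx with h
  · rw [if_pos (by positivity), Int.toNat_add h (by positivity), pow_add]
    exact Submodule.mul_mem_mul hx hy
  · rw [Submodule.mem_bot] at hx
    simp [hx]

theorem one_mem_symPow : (1 : SymmetricAlgebra ℂ V) ∈ symPow V (0 : ℕ) := by
  simp [symPow]

theorem ι_mem_symPow (v : V) : SymmetricAlgebra.ι ℂ V v ∈ symPow V (1 : ℕ) := by
  simp [symPow]

/-- The inclusion `⋀ⁱW ⊗ Symᵐ V ⊂ Sym V ⊗ ⋀W`, `x ⊗ p ↦ p ⊗ x`. -/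
def incl (i : ℕ) (m : ℤ) : (⋀[ℂ]^i W) ⊗[ℂ] (symPow V m) →ₗ[ℂ]
    SymmetricAlgebra ℂ V ⊗[ℂ] ExteriorAlgebra ℂ W :=
  (TensorProduct.comm ℂ (ExteriorAlgebra ℂ W) (SymmetricAlgebra ℂ V)).toLinearMap ∘ₗ
    TensorProduct.map (⋀[ℂ]^i W).subtype (symPow V m).subtype

theorem incl_tmul (i : ℕ) (m : ℤ) (x : ⋀[ℂ]^i W) (p : symPow V m) :
    incl W V i m (x ⊗ₜ p) = (p : SymmetricAlgebra ℂ V) ⊗ₜ (x : ExteriorAlgebra ℂ W) := rfl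

theorem incl_injective (i : ℕ) (m : ℤ) : Function.Injective (incl W V i m) := by
  refine (TensorProduct.comm ℂ _ _).injective.comp ?_
  exact TensorProduct.map_injective_of_flat_flat _ _ (Submodule.subtype_injective _)
    (Submodule.subtype_injective _)

variable (S : Type*) [CommRing S] [Algebra ℂ S]

/-- The inclusion `S ⊗ (⋀ⁱW ⊗ Symᵐ V) ⊂ (S ⊗ Sym V) ⊗ ⋀W`, `s ⊗ (x ⊗ p) ↦ (s ⊗ p) ⊗ x`. -/
def inclBase (i : ℕ) (m : ℤ) : S ⊗[ℂ] ((⋀[ℂ]^i W) ⊗[ℂ] (symPow V m)) →ₗ[S]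
    (S ⊗[ℂ] SymmetricAlgebra ℂ V) ⊗[ℂ] ExteriorAlgebra ℂ W :=
  (TensorProduct.AlgebraTensorModule.assoc ℂ ℂ S S (SymmetricAlgebra ℂ V)
    (ExteriorAlgebra ℂ W)).symm.toLinearMap ∘ₗ (incl W V i m).baseChange S

theorem inclBase_tmul (i : ℕ) (m : ℤ) (s : S) (x : ⋀[ℂ]^i W) (p : symPow V m) :
    inclBase W V S i m (s ⊗ₜ (x ⊗ₜ p)) =
      (s ⊗ₜ (p : SymmetricAlgebra ℂ V)) ⊗ₜ (x : ExteriorAlgebra ℂ W) := rfl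

theorem inclBase_injective (i : ℕ) (m : ℤ) : Function.Injective (inclBase W V S i m) := by
  refine (TensorProduct.AlgebraTensorModule.assoc ℂ ℂ S S (SymmetricAlgebra ℂ V)
    (ExteriorAlgebra ℂ W)).symm.injective.comp ?_
  exact Module.Flat.lTensor_preserves_injective_linearMap (M := S) _ (incl_injective W V i m)

theorem comul_mem (i : ℕ) (x : ExteriorAlgebra ℂ W) (hx : x ∈ ⋀[ℂ]^(i + 1) W) :
    comul W x ∈ LinearMap.range ((⋀[ℂ]^i W).subtype.lTensor W) := by
  rw [← ExteriorAlgebra.ιMulti_span_fixedDegree] at hx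
  induction hx using Submodule.span_induction with
  | mem x h =>
    obtain ⟨v, rfl⟩ := h
    rw [comul_ιMulti]
    refine Submodule.sum_mem _ fun j _ => zsmul_mem ?_ _
    exact ⟨v j ⊗ₜ exteriorPower.ιMulti ℂ i (j.removeNth v), by simp⟩
  | zero => simp
  | add x y _ _ hx hy => rw [map_add]; exact add_mem hx hy
  | smul c x _ hx => rw [map_smul]; exact Submodule.smul_mem _ c hx

variable {W V S}

theorem koszul_mem (g : W →ₗ[ℂ] S ⊗[ℂ] SymmetricAlgebra ℂ V) (r : ℕ)
    (hg : ∀ w, g w ∈ LinearMap.range ((symPow V r).subtype.lTensor S)) (i : ℕ) (m m' : ℤ)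
    (hm : m' = m + r) (y : S ⊗[ℂ] ((⋀[ℂ]^(i + 1) W) ⊗[ℂ] (symPow V m))) :
    koszul g (inclBase W V S (i + 1) m y) ∈ LinearMap.range (inclBase W V S i m') := by
  subst hm
  induction y with
  | zero => simp
  | add a b ha hb => rw [map_add, map_add]; exact add_mem ha hb
  | tmul s t =>
    induction t with
    | zero => simp
    | add a b ha hb => rw [TensorProduct.tmul_add, map_add, map_add]; exact add_mem ha hb
    | tmul x p =>
      rw [inclBase_tmul, koszul, LinearMap.liftBaseChange_tmul, LinearMap.comp_apply]
      obtain ⟨z, hz⟩ := comul_mem W i x x.2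
      rw [← hz]
      clear hz
      induction z with
      | zero => simp
      | add a b ha hb => rw [map_add, map_add, smul_add]; exact add_mem ha hb
      | tmul w x' =>
        rw [LinearMap.lTensor_tmul, LinearMap.rTensor_tmul, TensorProduct.smul_tmul']
        obtain ⟨q, hq⟩ := hg w
        rw [← hq]
        clear hq
        induction q with
        | zero => simp
        | add a b ha hb =>
          rw [map_add, smul_add, TensorProduct.add_tmul]; exact add_mem ha hb
        | tmul s' q =>
          exact ⟨(s * s') ⊗ₜ (x' ⊗ₜ ⟨p * q, mul_mem_symPow V p.2 q.2⟩), by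
            rw [inclBase_tmul, LinearMap.lTensor_tmul, smul_eq_mul,
              Algebra.TensorProduct.tmul_mul_tmul]
            rfl⟩
end

section schur
variable {S W V : Type u} [CommRing S] [Algebra ℂ S] [AddCommGroup W] [Module ℂ W]
  [AddCommGroup V] [Module ℂ V]

/-- For an `S`-linear map `φ : S ⊗ W → S ⊗ V` of free modules, the map
`W → S ⊗ V = S ⊗ Sym¹ V ⊂ S ⊗ Sym V`, `w ↦ φ (1 ⊗ w)`. -/
def schurForm (φ : S ⊗[ℂ] W →ₗ[S] S ⊗[ℂ] V) : W →ₗ[ℂ] S ⊗[ℂ] SymmetricAlgebra ℂ V :=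
  ((SymmetricAlgebra.ι ℂ V).baseChange S ∘ₗ φ).restrictScalars ℂ ∘ₗ TensorProduct.mk ℂ S W 1

/-- The term of homological degree `i` of the Schur complex `Symᵏ(φ)` of a map of free modules
`φ : F = S ⊗ W → G = S ⊗ V`, namely `⋀ⁱF ⊗ Symᵏ⁻ⁱG = S ⊗ (⋀ⁱW ⊗ Symᵏ⁻ⁱV)`. It is `0` for `i > k`. -/
abbrev SchurTerm (S W V : Type u) [CommRing S] [Algebra ℂ S] [AddCommGroup W] [Module ℂ W]
    [AddCommGroup V] [Module ℂ V] (k i : ℕ) : Type u :=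
  S ⊗[ℂ] ((⋀[ℂ]^i W) ⊗[ℂ] (symPow V ((k : ℤ) - (i : ℤ))))

theorem schurForm_mem (φ : S ⊗[ℂ] W →ₗ[S] S ⊗[ℂ] V) (w : W) :
    schurForm φ w ∈ LinearMap.range ((symPow V (1 : ℕ)).subtype.lTensor S) := by
  simp only [schurForm, LinearMap.comp_apply, LinearMap.restrictScalars_apply]
  generalize φ _ = z
  induction z with
  | zero => simp
  | add a b ha hb => rw [map_add]; exact add_mem ha hb
  | tmul s v => exact ⟨s ⊗ₜ ⟨_, ι_mem_symPow V v⟩, rfl⟩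

/-- The differential of `Symᵏ(φ)`: comultiplication on the exterior algebra, then `φ`, then
multiplication on the symmetric algebra,
`s ⊗ (w₀ ∧ ⋯ ∧ wᵢ) ⊗ p ↦ ∑ⱼ (-1)ʲ (w₀ ∧ ⋯ ŵⱼ ⋯ ∧ wᵢ) ⊗ (s φ(wⱼ)) p`; see `inclBase_schurD`. -/
def schurD (φ : S ⊗[ℂ] W →ₗ[S] S ⊗[ℂ] V) (k i : ℕ) :
    SchurTerm S W V k (i + 1) →ₗ[S] SchurTerm S W V k i :=
  LinearMap.codRestrictOfInjective
    ((koszul (schurForm φ)).restrictScalars S ∘ₗ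
      inclBase W V S (i + 1) ((k : ℤ) - ((i + 1 : ℕ) : ℤ)))
    (inclBase W V S i ((k : ℤ) - (i : ℤ)))
    (inclBase_injective W V S i _)
    (fun y => koszul_mem (schurForm φ) 1 (schurForm_mem φ) i _ _ (by push_cast; ring) y)

theorem inclBase_schurD (φ : S ⊗[ℂ] W →ₗ[S] S ⊗[ℂ] V) (k i : ℕ) (y : SchurTerm S W V k (i + 1)) :
    inclBase W V S i _ (schurD φ k i y) = koszul (schurForm φ) (inclBase W V S (i + 1) _ y) :=
  LinearMap.codRestrictOfInjective_comp_apply _ _ _ _ y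

theorem schurD_schurD (φ : S ⊗[ℂ] W →ₗ[S] S ⊗[ℂ] V) (k i : ℕ) :
    schurD φ k i ∘ₗ schurD φ k (i + 1) = 0 := by
  refine LinearMap.ext fun y => inclBase_injective W V S i _ ?_
  rw [LinearMap.comp_apply, inclBase_schurD, inclBase_schurD, koszul_koszul]
  simp

/-- The Schur complex `Symᵏ(φ)` of `φ : S ⊗ W → S ⊗ V`, with `V` in homological degree `0`. -/
def schurComplex (φ : S ⊗[ℂ] W →ₗ[S] S ⊗[ℂ] V) (k : ℕ) : ChainComplex (ModuleCat.{u} S) ℕ :=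
  ChainComplex.of (fun i => ModuleCat.of S (SchurTerm S W V k i))
    (fun i => ModuleCat.ofHom (schurD φ k i))
    (fun i => by rw [← ModuleCat.ofHom_comp, schurD_schurD]; rfl)
end schur

theorem koszul_assoc {S A W : Type*} [CommRing S] [Algebra ℂ S] [CommRing A] [Algebra ℂ A]
    [AddCommGroup W] [Module ℂ W] (g : W →ₗ[ℂ] A) (y : S ⊗[ℂ] (A ⊗[ℂ] ExteriorAlgebra ℂ W)) :
    koszul (TensorProduct.mk ℂ S A 1 ∘ₗ g)
      ((TensorProduct.AlgebraTensorModule.assoc ℂ ℂ S S A (ExteriorAlgebra ℂ W)).symm y) =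
    (TensorProduct.AlgebraTensorModule.assoc ℂ ℂ S S A (ExteriorAlgebra ℂ W)).symm
      (((koszul g).restrictScalars ℂ).lTensor S y) := by
  induction y with
  | zero => simp
  | add a b ha hb => simp only [map_add, ha, hb]
  | tmul s t =>
    induction t with
    | zero => simp
    | add a b ha hb => simp only [TensorProduct.tmul_add, map_add, ha, hb]
    | tmul p x =>
      simp only [TensorProduct.AlgebraTensorModule.assoc_symm_tmul, LinearMap.lTensor_tmul,
        koszul, LinearMap.restrictScalars_apply, LinearMap.liftBaseChange_tmul,
        LinearMap.comp_apply]
      generalize comul W x = z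
      induction z with
      | zero => simp
      | add a b ha hb => simp only [TensorProduct.tmul_add, map_add, smul_add, ha, hb]
      | tmul v x' => simp [TensorProduct.smul_tmul']

theorem lTensor_ker_exact (S : Type*) {M N : Type*} [CommRing S] [Algebra ℂ S] [AddCommGroup M]
    [Module ℂ M] [AddCommGroup N] [Module ℂ N] (f : M →ₗ[ℂ] N) :
    Function.Exact ((LinearMap.ker f).subtype.lTensor S) (f.lTensor S) :=
  Module.Flat.lTensor_exact S (LinearMap.exact_subtype_ker_map f)

section hook
variable (V : Type u) [AddCommGroup V] [Module ℂ V]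

/-- The differential `δ : ⋀ⁱV ⊗ SymⁿV → ⋀ⁱ⁻¹V ⊗ Symⁿ⁺¹V` of the Koszul complex, in all degrees. -/
def koszulDelta : SymmetricAlgebra ℂ V ⊗[ℂ] ExteriorAlgebra ℂ V →ₗ[ℂ]
    SymmetricAlgebra ℂ V ⊗[ℂ] ExteriorAlgebra ℂ V :=
  (koszul (SymmetricAlgebra.ι ℂ V)).restrictScalars ℂ

/-- The hook Schur functor `𝕊_(n,1ⁱ) V = ker (δ : ⋀ⁱV ⊗ SymⁿV → ⋀ⁱ⁻¹V ⊗ Symⁿ⁺¹V)`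
(all of `Symⁿ V` for `i = 0`). -/
def hook (n i : ℕ) : Submodule ℂ ((⋀[ℂ]^i V) ⊗[ℂ] (symPow V n)) :=
  LinearMap.ker (koszulDelta V ∘ₗ incl V V i n)

variable (S : Type u) [CommRing S] [Algebra ℂ S]

/-- The free `S`-module `S ⊗ 𝕊_(n,1ⁱ) V`. -/
abbrev ResTerm (n i : ℕ) : Type u := S ⊗[ℂ] hook V n i

/-- The inclusion `S ⊗ 𝕊_(n,1ⁱ) V ⊂ (S ⊗ Sym V) ⊗ ⋀V`. -/
def resIncl (n i : ℕ) : ResTerm V S n i →ₗ[S]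
    (S ⊗[ℂ] SymmetricAlgebra ℂ V) ⊗[ℂ] ExteriorAlgebra ℂ V :=
  inclBase V V S i n ∘ₗ (hook V n i).subtype.baseChange S

theorem resIncl_injective (n i : ℕ) : Function.Injective (resIncl V S n i) := by
  refine (inclBase_injective V V S i n).comp ?_
  exact Module.Flat.lTensor_preserves_injective_linearMap (M := S) _
    (hook V n i).injective_subtype

theorem koszul_inclBase (i : ℕ) (m : ℤ)
    (y : S ⊗[ℂ] ((⋀[ℂ]^i V) ⊗[ℂ] (symPow V m))) :
    koszul (TensorProduct.mk ℂ S (SymmetricAlgebra ℂ V) 1 ∘ₗ SymmetricAlgebra.ι ℂ V)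
      (inclBase V V S i m y) =
    (TensorProduct.AlgebraTensorModule.assoc ℂ ℂ S S (SymmetricAlgebra ℂ V)
      (ExteriorAlgebra ℂ V)).symm ((koszulDelta V ∘ₗ incl V V i m).lTensor S y) := by
  exact (koszul_assoc (SymmetricAlgebra.ι ℂ V) ((incl V V i m).lTensor S y)).trans
    (congrArg _ (LinearMap.lTensor_comp_apply S (koszulDelta V) (incl V V i m) y).symm)

theorem mem_range_resIncl (n i : ℕ) (z : S ⊗[ℂ] ((⋀[ℂ]^i V) ⊗[ℂ] (symPow V (n : ℤ))))
    (hz : koszul (TensorProduct.mk ℂ S (SymmetricAlgebra ℂ V) 1 ∘ₗ SymmetricAlgebra.ι ℂ V)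
      (inclBase V V S i n z) = 0) :
    inclBase V V S i n z ∈ LinearMap.range (resIncl V S n i) := by
  rw [koszul_inclBase, LinearEquiv.map_eq_zero_iff] at hz
  have hex := lTensor_ker_exact S (M := (⋀[ℂ]^i V) ⊗[ℂ] (symPow V (n : ℤ)))
    (N := SymmetricAlgebra ℂ V ⊗[ℂ] ExteriorAlgebra ℂ V) (koszulDelta V ∘ₗ incl V V i n)
  obtain ⟨u, hu⟩ := (hex z).1 hz
  exact ⟨u, congrArg (inclBase V V S i n) hu⟩

theorem koszul_resIncl (n i : ℕ) (y : ResTerm V S n i) :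
    koszul (TensorProduct.mk ℂ S (SymmetricAlgebra ℂ V) 1 ∘ₗ SymmetricAlgebra.ι ℂ V)
      (resIncl V S n i y) = 0 := by
  induction y using TensorProduct.induction_on with
  | zero => simp
  | add a b ha hb => rw [map_add, map_add, ha, hb, add_zero]
  | tmul s k =>
    rw [resIncl, LinearMap.comp_apply, LinearMap.baseChange_tmul, koszul_inclBase,
      LinearMap.lTensor_tmul]
    have hk : (koszulDelta V ∘ₗ incl V V i n) k = 0 := k.2
    rw [Submodule.subtype_apply, hk]
    simp

variable {V S}

/-- For `γ : V → S`, the map `V → S ⊗ Sym V`, `v ↦ γ v ⊗ 1`. -/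
def coeffForm (γ : V →ₗ[ℂ] S) : V →ₗ[ℂ] S ⊗[ℂ] SymmetricAlgebra ℂ V :=
  (TensorProduct.mk ℂ S (SymmetricAlgebra ℂ V)).flip 1 ∘ₗ γ

theorem resD_mem (γ : V →ₗ[ℂ] S) (n i : ℕ) (y : ResTerm V S n (i + 1)) :
    koszul (coeffForm γ) (resIncl V S n (i + 1) y) ∈ LinearMap.range (resIncl V S n i) := by
  obtain ⟨z, hz⟩ := koszul_mem (coeffForm γ) 0
    (fun v => ⟨γ v ⊗ₜ ⟨1, one_mem_symPow V⟩, rfl⟩) i n n (by simp)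
    ((hook V n (i + 1)).subtype.baseChange S y)
  have hz' : inclBase V V S i n z = koszul (coeffForm γ) (resIncl V S n (i + 1) y) := hz
  rw [← hz']
  apply mem_range_resIncl
  rw [hz', koszul_anticomm, koszul_resIncl]
  simp

/-- The differential `S ⊗ 𝕊_(n,1ⁱ⁺¹) V → S ⊗ 𝕊_(n,1ⁱ) V` for `γ : V → S`, the restriction of
`s ⊗ (v₀ ∧ ⋯ ∧ vᵢ) ⊗ p ↦ ∑ⱼ (-1)ʲ s γ(vⱼ) ⊗ (v₀ ∧ ⋯ v̂ⱼ ⋯ ∧ vᵢ) ⊗ p`; see `resIncl_resD`. -/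
def resD (γ : V →ₗ[ℂ] S) (n i : ℕ) : ResTerm V S n (i + 1) →ₗ[S] ResTerm V S n i :=
  LinearMap.codRestrictOfInjective
    ((koszul (coeffForm γ)).restrictScalars S ∘ₗ resIncl V S n (i + 1))
    (resIncl V S n i) (resIncl_injective V S n i) (resD_mem γ n i)

theorem resIncl_resD (γ : V →ₗ[ℂ] S) (n i : ℕ) (y : ResTerm V S n (i + 1)) :
    resIncl V S n i (resD γ n i y) = koszul (coeffForm γ) (resIncl V S n (i + 1) y) :=
  LinearMap.codRestrictOfInjective_comp_apply _ _ _ _ y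

theorem resD_resD (γ : V →ₗ[ℂ] S) (n i : ℕ) : resD γ n i ∘ₗ resD γ n (i + 1) = 0 := by
  refine LinearMap.ext fun y => resIncl_injective V S n i ?_
  rw [LinearMap.comp_apply, resIncl_resD, resIncl_resD, koszul_koszul]
  simp

variable (V)

/-- The complex `C_•` over `S = Sym V` with terms `S ⊗ 𝕊_(n,1ⁱ) V`:
`⋯ → S ⊗ 𝕊_(n,1) V → S ⊗ Symⁿ V → 0`. -/
def resComplex (n : ℕ) : ChainComplex (ModuleCat.{u} (SymmetricAlgebra ℂ V)) ℕ :=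
  ChainComplex.of (fun i => ModuleCat.of (SymmetricAlgebra ℂ V) (ResTerm V (SymmetricAlgebra ℂ V) n i))
    (fun i => ModuleCat.ofHom (resD (SymmetricAlgebra.ι ℂ V) n i))
    (fun i => by rw [← ModuleCat.ofHom_comp, resD_resD]; rfl)


/-- The identification `𝕊_(n) V = ⋀⁰V ⊗ Symⁿ V = Symⁿ V ⊂ Sym V`. -/
def augCoeff (n : ℕ) : hook V n 0 →ₗ[ℂ] SymmetricAlgebra ℂ V :=
  (symPow V (n : ℤ)).subtype ∘ₗ (TensorProduct.lid ℂ (symPow V (n : ℤ))).toLinearMap ∘ₗ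
    (exteriorPower.zeroEquiv ℂ V).toLinearMap.rTensor (symPow V (n : ℤ)) ∘ₗ (hook V n 0).subtype

/-- The augmentation `S ⊗ Symⁿ V → S`, `s ⊗ p ↦ s p`. -/
def resAug (n : ℕ) : ResTerm V (SymmetricAlgebra ℂ V) n 0 →ₗ[SymmetricAlgebra ℂ V]
    SymmetricAlgebra ℂ V :=
  LinearMap.liftBaseChange (SymmetricAlgebra ℂ V) (augCoeff V n)

/-- The ideal `m = (x₀, …, x_b)` of `S = Sym V`, generated by `V`. -/
def irrelevant : Ideal (SymmetricAlgebra ℂ V) :=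
  Ideal.span (Set.range (SymmetricAlgebra.ι ℂ V))

end hook

/-- `C`, augmented by `ε : C₀ → S`, is a minimal free resolution (by modules of finite rank) of the
ideal `I`: the sequence `⋯ → C₁ → C₀ → I → 0` is exact, and `d(Cᵢ₊₁) ⊆ m Cᵢ`. -/
structure IsMinimalFreeResolution {S : Type u} [CommRing S] (m I : Ideal S)
    (C : ChainComplex (ModuleCat.{u} S) ℕ) (ε : C.X 0 →ₗ[S] S) : Prop where
  free : ∀ i, Module.Free S (C.X i)
  finite : ∀ i, Module.Finite S (C.X i)
  exact_succ : ∀ i, Function.Exact (C.d (i + 2) (i + 1)).hom (C.d (i + 1) i).hom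
  exact_zero : Function.Exact (C.d 1 0).hom ε
  range_aug : LinearMap.range ε = I
  minimal : ∀ i, LinearMap.range (C.d (i + 1) i).hom ≤ m • (⊤ : Submodule S (C.X i))

section action
variable {V : Type u} [AddCommGroup V] [Module ℂ V]

/-- The action of `g ∈ GL(V)` on `S = Sym V`. -/
def symMap (g : V ≃ₗ[ℂ] V) : SymmetricAlgebra ℂ V →ₐ[ℂ] SymmetricAlgebra ℂ V :=
  SymmetricAlgebra.lift (SymmetricAlgebra.ι ℂ V ∘ₗ g.toLinearMap)

theorem symMap_mem (g : V ≃ₗ[ℂ] V) (m : ℤ) (p : SymmetricAlgebra ℂ V) (hp : p ∈ symPow V m) :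
    (symMap g).toLinearMap p ∈ symPow V m := by
  unfold symPow at *
  split_ifs at hp ⊢ with h
  · have h1 : (symMap g).toLinearMap p ∈
        ((LinearMap.range (SymmetricAlgebra.ι ℂ V)) ^ m.toNat).map (symMap g).toLinearMap :=
      Submodule.mem_map_of_mem hp
    rw [Submodule.map_pow] at h1
    have h2 : (LinearMap.range (SymmetricAlgebra.ι ℂ V)).map (symMap g).toLinearMap ≤
        LinearMap.range (SymmetricAlgebra.ι ℂ V) := by
      rintro _ ⟨_, ⟨v, rfl⟩, rfl⟩
      exact ⟨g v, by simp [symMap]⟩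
    have h3 := pow_le_pow_left' h2 m.toNat
    exact h3 h1
  · rw [Submodule.mem_bot] at *
    simp [hp]

/-- The action of `g ∈ GL(V)` on `Symᵐ V`. -/
def symPowMap (g : V ≃ₗ[ℂ] V) (m : ℤ) : symPow V m →ₗ[ℂ] symPow V m :=
  (symMap g).toLinearMap.restrict (symMap_mem g m)

theorem comul_map (g : V ≃ₗ[ℂ] V) (x : ExteriorAlgebra ℂ V) :
    comul V (ExteriorAlgebra.map g.toLinearMap x) =
      TensorProduct.map g.toLinearMap (ExteriorAlgebra.map g.toLinearMap).toLinearMap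
        (comul V x) := by
  have key : comul V ∘ₗ (ExteriorAlgebra.map g.toLinearMap).toLinearMap =
      TensorProduct.map g.toLinearMap (ExteriorAlgebra.map g.toLinearMap).toLinearMap ∘ₗ
        comul V := by
    apply ExteriorAlgebra.lhom_ext
    intro n
    ext v
    cases n with
    | zero =>
      simp only [LinearMap.compAlternatingMap_apply, LinearMap.comp_apply,
        ExteriorAlgebra.ιMulti_zero_apply, AlgHom.toLinearMap_apply, map_one, comul_one, map_zero]
    | succ n =>
      simp only [LinearMap.compAlternatingMap_apply, LinearMap.comp_apply,
        AlgHom.toLinearMap_apply, ExteriorAlgebra.map_apply_ιMulti, comul_ιMulti, map_sum,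
        map_zsmul, TensorProduct.map_tmul]
      rfl
  exact LinearMap.congr_fun key x

theorem koszulDelta_map (g : V ≃ₗ[ℂ] V) (i : ℕ) (n : ℤ)
    (z : (⋀[ℂ]^i V) ⊗[ℂ] (symPow V n)) :
    koszulDelta V (incl V V i n
      (TensorProduct.map (exteriorPower.map i g.toLinearMap) (symPowMap g n) z)) =
    TensorProduct.map (symMap g).toLinearMap (ExteriorAlgebra.map g.toLinearMap).toLinearMap
      (koszulDelta V (incl V V i n z)) := by
  induction z using TensorProduct.induction_on with
  | zero => simp
  | add a b ha hb => simp only [map_add, ha, hb]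
  | tmul x p =>
    have hx : ((exteriorPower.map i g.toLinearMap x : ⋀[ℂ]^i V) : ExteriorAlgebra ℂ V) =
        ExteriorAlgebra.map g.toLinearMap x := by
      have : (⋀[ℂ]^i V).subtype ∘ₗ exteriorPower.map i g.toLinearMap =
          (ExteriorAlgebra.map g.toLinearMap).toLinearMap ∘ₗ (⋀[ℂ]^i V).subtype := by
        apply exteriorPower.linearMap_ext
        ext v
        simp [ExteriorAlgebra.map_apply_ιMulti]
      exact LinearMap.congr_fun this x
    have hp : ((symPowMap g n p : symPow V n) : SymmetricAlgebra ℂ V) = symMap g p := rfl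
    rw [TensorProduct.map_tmul, incl_tmul, incl_tmul, hx, hp]
    simp only [koszulDelta, koszul, LinearMap.restrictScalars_apply,
      LinearMap.liftBaseChange_tmul, LinearMap.comp_apply, comul_map]
    generalize comul V (x : ExteriorAlgebra ℂ V) = y
    induction y using TensorProduct.induction_on with
    | zero => simp
    | add a b ha hb => simp only [map_add, smul_add, ha, hb]
    | tmul v x' => simp [TensorProduct.smul_tmul', symMap]

/-- The action of `g ∈ GL(V)` on `𝕊_(n,1ⁱ) V`, restricted from `⋀ⁱV ⊗ Symⁿ V`. -/
def hookMap (g : V ≃ₗ[ℂ] V) (n i : ℕ) : hook V n i →ₗ[ℂ] hook V n i :=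
  (TensorProduct.map (exteriorPower.map i g.toLinearMap) (symPowMap g n)).restrict
    (fun z hz => by
      have h0 : koszulDelta V (incl V V i n z) = 0 := hz
      have h1 := koszulDelta_map g i n z
      rw [h0, map_zero] at h1
      exact h1)

/-- The (semilinear) action of `g ∈ GL(V)` on `S ⊗ 𝕊_(n,1ⁱ) V`. -/
def resAct (g : V ≃ₗ[ℂ] V) (n i : ℕ) : ResTerm V (SymmetricAlgebra ℂ V) n i →ₗ[ℂ]
    ResTerm V (SymmetricAlgebra ℂ V) n i :=
  TensorProduct.map (symMap g).toLinearMap (hookMap g n i)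
end action

section psi
variable (V : Type u) [AddCommGroup V] [Module ℂ V]

/-- The Koszul differential `φ : S ⊗ ⋀²V → S ⊗ V`, `u ∧ v ↦ u · (1 ⊗ v) - v · (1 ⊗ u)`,
over `S = Sym V`. -/
def koszulPhi : SymmetricAlgebra ℂ V ⊗[ℂ] (⋀[ℂ]^2 V) →ₗ[SymmetricAlgebra ℂ V]
    SymmetricAlgebra ℂ V ⊗[ℂ] V :=
  LinearMap.liftBaseChange (SymmetricAlgebra ℂ V)
    ((SymmetricAlgebra.ι ℂ V).rTensor V ∘ₗ wedgeIncl V)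

/-- The map `V ⊗ V → ⋀¹V ⊗ Sym¹V`, `v ⊗ u ↦ v ⊗ u`, into the Koszul algebra `Sym V ⊗ ⋀V`. -/
def tensorToKoszul : V ⊗[ℂ] V →ₗ[ℂ] SymmetricAlgebra ℂ V ⊗[ℂ] ExteriorAlgebra ℂ V :=
  (TensorProduct.comm ℂ (ExteriorAlgebra ℂ V) (SymmetricAlgebra ℂ V)).toLinearMap ∘ₗ
    TensorProduct.map (ExteriorAlgebra.ι ℂ) (SymmetricAlgebra.ι ℂ V)

theorem tensorToKoszul_tmul (v u : V) : tensorToKoszul V (v ⊗ₜ u) =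
    SymmetricAlgebra.ι ℂ V u ⊗ₜ ExteriorAlgebra.ι ℂ v := rfl

theorem tensorToKoszul_swap (a b : V ⊗[ℂ] V) :
    tensorToKoszul V a * tensorToKoszul V b + tensorToKoszul V b * tensorToKoszul V a = 0 := by
  induction a using TensorProduct.induction_on with
  | zero => simp
  | add a a' ha ha' =>
    rw [map_add, add_mul, mul_add, add_add_add_comm, ha, ha', add_zero]
  | tmul v u =>
    induction b using TensorProduct.induction_on with
    | zero => simp
    | add b b' hb hb' =>
      rw [map_add, add_mul, mul_add, add_add_add_comm, hb, hb', add_zero]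
    | tmul v' u' =>
      rw [tensorToKoszul_tmul, tensorToKoszul_tmul, Algebra.TensorProduct.tmul_mul_tmul,
        Algebra.TensorProduct.tmul_mul_tmul, mul_comm (SymmetricAlgebra.ι ℂ V u'),
        ← TensorProduct.tmul_add, ExteriorAlgebra.ι_add_mul_swap, TensorProduct.tmul_zero]

theorem tensorToKoszul_sq (a : V ⊗[ℂ] V) : tensorToKoszul V a * tensorToKoszul V a = 0 := by
  have h := tensorToKoszul_swap V a a
  rw [← two_smul ℂ] at h
  simpa using h

/-- The multiplication `⋀ⁱ(V ⊗ V) → ⋀ⁱV ⊗ SymⁱV`, in all degrees: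
`(v₁ ⊗ u₁) ∧ ⋯ ∧ (vᵢ ⊗ uᵢ) ↦ (v₁ ∧ ⋯ ∧ vᵢ) ⊗ u₁⋯uᵢ`. -/
def koszulMul : ExteriorAlgebra ℂ (V ⊗[ℂ] V) →ₐ[ℂ]
    SymmetricAlgebra ℂ V ⊗[ℂ] ExteriorAlgebra ℂ V :=
  ExteriorAlgebra.lift ℂ ⟨tensorToKoszul V, tensorToKoszul_sq V⟩

/-- The composition
`⋀ⁱ(⋀²V) ⊗ SymʲV → ⋀ⁱ(V ⊗ V) ⊗ SymʲV → ⋀ⁱV ⊗ SymⁱV ⊗ SymʲV → ⋀ⁱV ⊗ Symⁱ⁺ʲV`, in all degrees. -/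
def psiAmbient : ExteriorAlgebra ℂ (⋀[ℂ]^2 V) ⊗[ℂ] SymmetricAlgebra ℂ V →ₗ[ℂ]
    SymmetricAlgebra ℂ V ⊗[ℂ] ExteriorAlgebra ℂ V :=
  LinearMap.mul' ℂ (SymmetricAlgebra ℂ V ⊗[ℂ] ExteriorAlgebra ℂ V) ∘ₗ
    TensorProduct.map
      ((koszulMul V).comp (ExteriorAlgebra.map (wedgeIncl V))).toLinearMap
      (Algebra.TensorProduct.includeLeft :
        SymmetricAlgebra ℂ V →ₐ[ℂ] SymmetricAlgebra ℂ V ⊗[ℂ] ExteriorAlgebra ℂ V).toLinearMap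

theorem psiAmbient_tmul (x : ExteriorAlgebra ℂ (⋀[ℂ]^2 V)) (p : SymmetricAlgebra ℂ V) :
    psiAmbient V (x ⊗ₜ p) = koszulMul V (ExteriorAlgebra.map (wedgeIncl V) x) * (p ⊗ₜ 1) := rfl

theorem psiAmbient_ι_mul (w : ⋀[ℂ]^2 V) (x : ExteriorAlgebra ℂ (⋀[ℂ]^2 V))
    (p : SymmetricAlgebra ℂ V) :
    psiAmbient V ((ExteriorAlgebra.ι ℂ w * x) ⊗ₜ p) =
      tensorToKoszul V (wedgeIncl V w) * psiAmbient V (x ⊗ₜ p) := by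
  simp only [psiAmbient_tmul, map_mul, ExteriorAlgebra.map_apply_ι, koszulMul,
    ExteriorAlgebra.lift_ι_apply, mul_assoc]

theorem tensorToKoszul_mul_mem (t : V ⊗[ℂ] V) (i : ℕ) (m : ℤ)
    (y : SymmetricAlgebra ℂ V ⊗[ℂ] ExteriorAlgebra ℂ V)
    (hy : y ∈ LinearMap.range (incl V V i m)) :
    tensorToKoszul V t * y ∈ LinearMap.range (incl V V (i + 1) (m + 1)) := by
  obtain ⟨z, rfl⟩ := hy
  induction z using TensorProduct.induction_on with
  | zero => simp
  | add a b ha hb => rw [map_add, mul_add]; exact add_mem ha hb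
  | tmul x p =>
    induction t using TensorProduct.induction_on with
    | zero => simp
    | add a b ha hb => rw [map_add, add_mul]; exact add_mem ha hb
    | tmul v u =>
      refine ⟨⟨ExteriorAlgebra.ι ℂ v * x, ?_⟩ ⊗ₜ ⟨p * SymmetricAlgebra.ι ℂ V u,
        mul_mem_symPow V p.2 (ι_mem_symPow V u)⟩, ?_⟩
      · change _ ∈ LinearMap.range (ExteriorAlgebra.ι ℂ (M := V)) ^ (i + 1)
        rw [pow_succ']
        exact Submodule.mul_mem_mul ⟨v, rfl⟩ x.2
      · rw [incl_tmul, incl_tmul, tensorToKoszul_tmul, Algebra.TensorProduct.tmul_mul_tmul,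
          mul_comm (SymmetricAlgebra.ι ℂ V u)]

theorem psiAmbient_mem (i : ℕ) (m m' : ℤ) (hm : m' = m + i)
    (x : ExteriorAlgebra ℂ (⋀[ℂ]^2 V)) (hx : x ∈ ⋀[ℂ]^i (⋀[ℂ]^2 V))
    (p : SymmetricAlgebra ℂ V) (hp : p ∈ symPow V m) :
    psiAmbient V (x ⊗ₜ p) ∈ LinearMap.range (incl V V i m') := by
  subst hm
  have hx' : x ∈ Submodule.span ℂ
      (Set.range (ExteriorAlgebra.ιMulti ℂ i (M := ⋀[ℂ]^2 V))) := by
    rw [ExteriorAlgebra.ιMulti_span_fixedDegree]; exact hx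
  clear hx
  induction hx' using Submodule.span_induction with
  | mem x h =>
    obtain ⟨v, rfl⟩ := h
    induction i with
    | zero =>
      rw [ExteriorAlgebra.ιMulti_zero_apply]
      refine ⟨⟨1, by simp⟩ ⊗ₜ ⟨p, by simpa using hp⟩, ?_⟩
      rw [incl_tmul, psiAmbient_tmul]
      simp
    | succ i ih =>
      rw [ExteriorAlgebra.ιMulti_succ_apply, psiAmbient_ι_mul]
      have := tensorToKoszul_mul_mem V (wedgeIncl V (v 0)) i _ _ (ih (Matrix.vecTail v))
      rwa [add_assoc] at this
  | zero => simp
  | add x y _ _ hx hy => rw [TensorProduct.add_tmul, map_add]; exact add_mem hx hy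
  | smul c x _ hx =>
    rw [← TensorProduct.smul_tmul', map_smul]; exact Submodule.smul_mem _ c hx

theorem koszulDelta_mul (w : ⋀[ℂ]^2 V) (y : SymmetricAlgebra ℂ V ⊗[ℂ] ExteriorAlgebra ℂ V) :
    koszulDelta V (tensorToKoszul V (wedgeIncl V w) * y) =
      - (tensorToKoszul V (wedgeIncl V w) * koszulDelta V y) := by
  have h1 : ∀ v u : V, ∀ y, koszulDelta V (tensorToKoszul V (v ⊗ₜ u) * y) =
      (SymmetricAlgebra.ι ℂ V u * SymmetricAlgebra.ι ℂ V v) • y -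
        tensorToKoszul V (v ⊗ₜ u) * koszulDelta V y := by
    intro v u y
    have e : ∀ y : SymmetricAlgebra ℂ V ⊗[ℂ] ExteriorAlgebra ℂ V,
        tensorToKoszul V (v ⊗ₜ u) * y =
        SymmetricAlgebra.ι ℂ V u • ((1 ⊗ₜ[ℂ] ExteriorAlgebra.ι ℂ v) * y) := by
      intro y
      rw [tensorToKoszul_tmul, ← smul_mul_assoc, TensorProduct.smul_tmul', smul_eq_mul, mul_one]
    rw [e, e, koszulDelta, LinearMap.restrictScalars_apply, map_smul, koszul_ι_mul, smul_sub,
      smul_smul]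
    rfl
  have h2 : ∀ w : ⋀[ℂ]^2 V, ∀ y, koszulDelta V (tensorToKoszul V (wedgeIncl V w) * y) +
      (tensorToKoszul V (wedgeIncl V w) * koszulDelta V y) = 0 := by
    intro w y
    have hw : w ∈ Submodule.span ℂ (Set.range (exteriorPower.ιMulti ℂ 2 (M := V))) := by
      rw [exteriorPower.ιMulti_span]; trivial
    induction hw using Submodule.span_induction with
    | mem w h =>
      obtain ⟨v, rfl⟩ := h
      rw [wedgeIncl_apply, map_sub, sub_mul, map_sub, sub_mul, h1, h1,
        mul_comm (SymmetricAlgebra.ι ℂ V (v 0))]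
      abel
    | zero => simp
    | add a b _ _ ha hb =>
      rw [map_add, map_add, add_mul, map_add, add_mul, add_add_add_comm, ha, hb, add_zero]
    | smul c a _ ha =>
      rw [map_smul, map_smul, smul_mul_assoc, smul_mul_assoc, map_smul, ← smul_add, ha, smul_zero]
  exact eq_neg_of_add_eq_zero_left (h2 w y)

theorem koszulDelta_psiAmbient (x : ExteriorAlgebra ℂ (⋀[ℂ]^2 V)) (p : SymmetricAlgebra ℂ V) :
    koszulDelta V (psiAmbient V (x ⊗ₜ p)) = 0 := by
  induction x using CliffordAlgebra.left_induction with
  | algebraMap r =>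
    have : psiAmbient V ((algebraMap ℂ (ExteriorAlgebra ℂ (⋀[ℂ]^2 V)) r) ⊗ₜ p) =
        r • (p ⊗ₜ 1) := by
      rw [psiAmbient_tmul, AlgHom.commutes, AlgHom.commutes]
      exact (Algebra.smul_def r _).symm
    refine (congrArg _ this).trans ?_
    rw [map_smul, koszulDelta, LinearMap.restrictScalars_apply, koszul_tmul_one, smul_zero]
  | add x y hx hy => rw [TensorProduct.add_tmul, map_add, map_add, hx, hy, add_zero]
  | ι_mul x w hx =>
    refine (congrArg _ (psiAmbient_ι_mul V w x p)).trans ?_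
    rw [koszulDelta_mul, hx, mul_zero, neg_zero]

theorem psiFull_mem (n i : ℕ)
    (y : (⋀[ℂ]^i (⋀[ℂ]^2 V)) ⊗[ℂ] (symPow V ((n : ℤ) - (i : ℤ)))) :
    psiAmbient V (TensorProduct.map (⋀[ℂ]^i (⋀[ℂ]^2 V)).subtype
      (symPow V ((n : ℤ) - (i : ℤ))).subtype y) ∈
      LinearMap.range (incl V V i n ∘ₗ (hook V n i).subtype) := by
  induction y using TensorProduct.induction_on with
  | zero => simp
  | add a b ha hb => rw [map_add, map_add]; exact add_mem ha hb
  | tmul x p =>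
    rw [TensorProduct.map_tmul]
    obtain ⟨z, hz⟩ := psiAmbient_mem V i _ n (by ring) x x.2 p p.2
    have hk : koszulDelta V (incl V V i n z) = 0 := by
      rw [hz]; exact koszulDelta_psiAmbient V x p
    exact ⟨⟨z, hk⟩, hz⟩

/-- The map `ψ_{i,n-i}(⋀²V) : ⋀ⁱ(⋀²V) ⊗ Symⁿ⁻ⁱV → 𝕊_(n,1ⁱ) V`: the composition `psiAmbient`, which
takes values in `𝕊_(n,1ⁱ) V ⊂ ⋀ⁱV ⊗ SymⁿV`. -/
def psiFull (n i : ℕ) : (⋀[ℂ]^i (⋀[ℂ]^2 V)) ⊗[ℂ] (symPow V ((n : ℤ) - (i : ℤ))) →ₗ[ℂ]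
    hook V n i :=
  LinearMap.codRestrictOfInjective
    (psiAmbient V ∘ₗ TensorProduct.map (⋀[ℂ]^i (⋀[ℂ]^2 V)).subtype
      (symPow V ((n : ℤ) - (i : ℤ))).subtype)
    (incl V V i n ∘ₗ (hook V n i).subtype)
    ((incl_injective V V i n).comp (hook V n i).injective_subtype)
    (psiFull_mem V n i)

variable {V}

/-- The map `ψ_{i,n-i}(V₁)`, the restriction of `ψ_{i,n-i}(⋀²V)` to `⋀ⁱV₁ ⊗ Symⁿ⁻ⁱV`. -/
def psi (V₁ : Submodule ℂ (⋀[ℂ]^2 V)) (n i : ℕ) :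
    (⋀[ℂ]^i V₁) ⊗[ℂ] (symPow V ((n : ℤ) - (i : ℤ))) →ₗ[ℂ] hook V n i :=
  psiFull V n i ∘ₗ
    (exteriorPower.map i V₁.subtype).rTensor (symPow V ((n : ℤ) - (i : ℤ)))

/-- The restriction `φ|_{V₁ ⊗ S} : S ⊗ V₁ → S ⊗ V`. -/
def koszulPhiRestrict (V₁ : Submodule ℂ (⋀[ℂ]^2 V)) :
    SymmetricAlgebra ℂ V ⊗[ℂ] V₁ →ₗ[SymmetricAlgebra ℂ V] SymmetricAlgebra ℂ V ⊗[ℂ] V :=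
  koszulPhi V ∘ₗ V₁.subtype.baseChange (SymmetricAlgebra ℂ V)
end psi
end HookResolution
end

open HookResolution

/-! Everything rests on the homotopy between the Koszul and the de Rham differential in
characteristic zero. On `T ⊗ ⋀V`, let e contract with a linear form `γ : V → T`, and let d be the de
Rham differential of a derivation with `D (γ v) = 1 ⊗ v`. Then e d + d e is multiplication by the
coefficient degree plus the exterior degree (`koszul_deRham_add`). For T = Sym V this makes the
Koszul complex exact in positive symmetric degree (`exists_koszulDelta_eq`), so there the hook, a
kernel of δ, is also an image of δ.

Surjectivity of ψ. For i = k + 1 a hook element is a sum of terms δ(pq ⊗ x) = p δ(q ⊗ x) with p in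
Symᵐ and q in Symᵏ. The element w = δ(q ⊗ x) is δ-closed of bidegree (k+1, k+1), hence δ d w =
2(k+1) w. By polarization w is a sum of terms uᵏ⁺¹ ⊗ x', and d (uᵏ⁺¹ ⊗ x') = (k+1) uᵏ ⊗ (u ∧ x').
Finally uᵏ δ(u ∧ v₀ ∧ ⋯ ∧ vₖ) is, up to sign, the image of the product of the bivectors u ∧ vⱼ
(`exists_koszulMul_eq`).

Exactness of C. The terms of C form the kernel of the Koszul differential e₂ of the second symmetric
factor in Sym V ⊗ Sym V ⊗ ⋀V, and the differential of C is the Koszul differential e₁ of the first.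
These anticommute. Let d be the de Rham differential in the first factor and N = e₁ d + d e₁. If z
is closed for both, then N z = e₁ (d z), but d z need not be e₂-closed. Its defect e₂ d z is again
closed for both and has smaller degree in the first factor, so by induction it equals e₁ r with e₂ r
= 0. Koszul exactness gives r = e₂ t, and d z + e₁ t is the required lift (`exists_koszulFst_eq`).
The only obstruction sits where N is zero, and the augmentation detects it.

Minimality holds because e₁ has coefficients in V. Equivariance and the chain map identity are
checked in the ambient algebras, where the maps are given by algebra homomorphisms and contractions
and can be compared on generators. -/

namespace HookResolution

/-! ### The de Rham differential and the homotopy formula -/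

section deRham
variable {T V : Type*} [CommRing T] [Algebra ℂ T] [AddCommGroup V] [Module ℂ V]

/-- A section of `TrivSqZeroExt.fst` gives a derivation. -/
theorem exists_derivation_of_algHom {M : Type*} [AddCommGroup M] [Module T M] [Module ℂ M]
    [IsScalarTower ℂ T M] [Module Tᵐᵒᵖ M] [IsCentralScalar T M]
    (F : T →ₐ[ℂ] TrivSqZeroExt T M)
    (hF : ∀ t, (F t).fst = t) : ∃ D : Derivation ℂ T M, ∀ t, D t = (F t).snd := by
  refine ⟨Derivation.mk' ((TrivSqZeroExt.sndHom T M).restrictScalars ℂ ∘ₗ F.toLinearMap) ?_,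
    fun t => rfl⟩
  intro a b
  change (F (a * b)).snd = a • (F b).snd + b • (F a).snd
  rw [map_mul, TrivSqZeroExt.snd_mul, hF, hF, op_smul_eq_smul]

variable (T V) in
/-- The inclusion `T ⊗ V = T ⊗ ⋀¹V ⊂ T ⊗ ⋀V`. -/
noncomputable def oneForm : T ⊗[ℂ] V →ₗ[T] T ⊗[ℂ] ExteriorAlgebra ℂ V :=
  (ExteriorAlgebra.ι ℂ).baseChange T

@[simp] theorem oneForm_tmul (t : T) (v : V) :
    oneForm T V (t ⊗ₜ v) = t ⊗ₜ ExteriorAlgebra.ι ℂ v := rfl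

theorem oneForm_mul_ι (y : T ⊗[ℂ] V) (v : V) (z : T ⊗[ℂ] ExteriorAlgebra ℂ V) :
    oneForm T V y * ((1 ⊗ₜ ExteriorAlgebra.ι ℂ v) * z) =
      -((1 ⊗ₜ ExteriorAlgebra.ι ℂ v) * (oneForm T V y * z)) := by
  rw [← mul_assoc, ← mul_assoc, ← neg_mul]
  congr 1
  induction y with
  | zero => simp
  | add a b ha hb => rw [map_add, add_mul, mul_add, ha, hb, neg_add]
  | tmul t w =>
    rw [oneForm_tmul, Algebra.TensorProduct.tmul_mul_tmul, Algebra.TensorProduct.tmul_mul_tmul,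
      eq_neg_of_add_eq_zero_left (ExteriorAlgebra.ι_add_mul_swap w v), mul_one, one_mul,
      TensorProduct.tmul_neg]

/-- Contraction is an antiderivation. This extends `koszul_ι_mul` from constant one-forms to
one-forms with coefficients, such as `D t`. -/
theorem koszul_oneForm_mul (γ : V →ₗ[ℂ] T) (y : T ⊗[ℂ] V) (z : T ⊗[ℂ] ExteriorAlgebra ℂ V) :
    koszul γ (oneForm T V y * z) =
      LinearMap.liftBaseChange T γ y • z - oneForm T V y * koszul γ z := by
  induction y with
  | zero => simp
  | add a b ha hb => simp only [map_add, add_mul, add_smul, ha, hb]; abel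
  | tmul t v =>
    have h : ∀ z : T ⊗[ℂ] ExteriorAlgebra ℂ V,
        oneForm T V (t ⊗ₜ v) * z = t • ((1 ⊗ₜ ExteriorAlgebra.ι ℂ v) * z) := fun z => by
      rw [← smul_mul_assoc, TensorProduct.smul_tmul', smul_eq_mul, mul_one, oneForm_tmul]
    rw [h, h, map_smul, koszul_ι_mul, smul_sub, LinearMap.liftBaseChange_tmul, smul_smul,
      smul_eq_mul]

/-- The de Rham differential `t ⊗ x ↦ Dt ∧ x` of a derivation `D : T → T ⊗ V`. -/
noncomputable def deRham (D : Derivation ℂ T (T ⊗[ℂ] V)) :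
    T ⊗[ℂ] ExteriorAlgebra ℂ V →ₗ[ℂ] T ⊗[ℂ] ExteriorAlgebra ℂ V :=
  TensorProduct.lift ((LinearMap.mul ℂ (T ⊗[ℂ] ExteriorAlgebra ℂ V)).compl₁₂
    ((oneForm T V).restrictScalars ℂ ∘ₗ D.toLinearMap)
    (TensorProduct.mk ℂ T (ExteriorAlgebra ℂ V) 1))

variable (D : Derivation ℂ T (T ⊗[ℂ] V))

theorem deRham_tmul (t : T) (x : ExteriorAlgebra ℂ V) :
    deRham D (t ⊗ₜ x) = oneForm T V (D t) * (1 ⊗ₜ x) := rfl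

theorem deRham_smul (t : T) (y : T ⊗[ℂ] ExteriorAlgebra ℂ V) :
    deRham D (t • y) = oneForm T V (D t) * y + t • deRham D y := by
  induction y with
  | zero => simp
  | add a b ha hb => simp only [smul_add, map_add, mul_add, ha, hb]; abel
  | tmul s x =>
    have h : (s ⊗ₜ[ℂ] x) = s • ((1 : T) ⊗ₜ[ℂ] x) := by simp [TensorProduct.smul_tmul']
    rw [TensorProduct.smul_tmul', deRham_tmul, deRham_tmul, smul_eq_mul, D.leibniz, map_add,
      map_smul, map_smul, add_mul, h, mul_smul_comm, smul_mul_assoc, smul_mul_assoc, add_comm]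

theorem deRham_ι_mul (v : V) (y : T ⊗[ℂ] ExteriorAlgebra ℂ V) :
    deRham D ((1 ⊗ₜ ExteriorAlgebra.ι ℂ v) * y) =
      -((1 ⊗ₜ ExteriorAlgebra.ι ℂ v) * deRham D y) := by
  induction y with
  | zero => simp
  | add a b ha hb => simp only [mul_add, map_add, ha, hb]; abel
  | tmul s x =>
    rw [Algebra.TensorProduct.tmul_mul_tmul, one_mul, deRham_tmul, deRham_tmul, ← oneForm_mul_ι,
      Algebra.TensorProduct.tmul_mul_tmul, one_mul]

theorem deRham_one_tmul (x : ExteriorAlgebra ℂ V) : deRham D (1 ⊗ₜ x) = 0 := by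
  rw [deRham_tmul, D.map_one_eq_zero, map_zero, zero_mul]

variable {D} {γ : V →ₗ[ℂ] T} (hD : ∀ v, D (γ v) = 1 ⊗ₜ v)

/-- Induction on the exterior power, one factor on the left at a time. -/
theorem exteriorPower_induction {C : ℕ → ExteriorAlgebra ℂ V → Prop}
    (one : C 0 1) (add : ∀ i x y, C i x → C i y → C i (x + y))
    (smul : ∀ i (c : ℂ) x, C i x → C i (c • x))
    (ι_mul : ∀ i v x, x ∈ ⋀[ℂ]^i V → C i x → C (i + 1) (ExteriorAlgebra.ι ℂ v * x))
    (i : ℕ) (x : ExteriorAlgebra ℂ V) (hx : x ∈ ⋀[ℂ]^i V) : C i x := by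
  change x ∈ LinearMap.range (ExteriorAlgebra.ι ℂ (M := V)) ^ i at hx
  induction hx using Submodule.pow_induction_on_left' with
  | algebraMap r =>
    rw [Algebra.algebraMap_eq_smul_one]; exact smul _ _ _ one
  | add x y i hx hy h1 h2 => exact add _ _ _ h1 h2
  | mem_mul m hm i x hx h =>
    obtain ⟨v, rfl⟩ := hm
    exact ι_mul i v x hx h

include hD in
-- With constant coefficients d kills `1 ⊗ x`, so this is already the whole homotopy formula in that
-- case. Each new factor v adds one: e (v ∧ x) = γ(v) x - v ∧ e x, and d turns the first summand
-- into v ∧ x.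
theorem deRham_koszul_one_tmul (i : ℕ) (x : ExteriorAlgebra ℂ V) (hx : x ∈ ⋀[ℂ]^i V) :
    deRham D (koszul γ (1 ⊗ₜ x)) = (i : ℂ) • ((1 : T) ⊗ₜ[ℂ] x) := by
  refine exteriorPower_induction (C := fun i x => deRham D (koszul γ (1 ⊗ₜ x)) =
    (i : ℂ) • ((1 : T) ⊗ₜ[ℂ] x)) ?_ ?_ ?_ ?_ i x hx
  · simp [koszul_tmul_one]
  · intro i x y hx hy
    simp only [TensorProduct.tmul_add, map_add, smul_add, hx, hy]
  · intro i c x hx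
    rw [TensorProduct.tmul_smul, ← algebraMap_smul T c, map_smul, algebraMap_smul, map_smul, hx,
      algebraMap_smul, smul_comm]
  · intro i v x _ hx
    have h : (1 : T) ⊗ₜ[ℂ] (ExteriorAlgebra.ι ℂ v * x) =
        (1 ⊗ₜ ExteriorAlgebra.ι ℂ v) * ((1 : T) ⊗ₜ[ℂ] x) := by simp
    rw [h, koszul_ι_mul, map_sub, deRham_smul, hD, oneForm_tmul, deRham_one_tmul, smul_zero,
      add_zero, deRham_ι_mul, hx, sub_neg_eq_add, mul_smul_comm]
    push_cast
    rw [add_smul, one_smul, add_comm]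

include hD in
/-- The homotopy formula: `d e + e d` is multiplication by the total degree. -/
theorem koszul_deRham_add (c : ℂ) (t : T) (ht : LinearMap.liftBaseChange T γ (D t) = c • t) (i : ℕ)
    (x : ExteriorAlgebra ℂ V) (hx : x ∈ ⋀[ℂ]^i V) :
    koszul γ (deRham D (t ⊗ₜ x)) + deRham D (koszul γ (t ⊗ₜ x)) = (c + i) • (t ⊗ₜ[ℂ] x) := by
  have h : (t ⊗ₜ[ℂ] x) = t • ((1 : T) ⊗ₜ[ℂ] x) := by simp [TensorProduct.smul_tmul']
  -- e d contributes -Dt ∧ e x and d e contributes +Dt ∧ e x; these cancel, leaving the Euler term c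
  -- and the constant-coefficient term i.
  rw [deRham_tmul, koszul_oneForm_mul, ht, h, map_smul, deRham_smul,
    deRham_koszul_one_tmul hD i x hx, add_smul, smul_assoc]
  rw [smul_comm t]
  abel

/-! Homogeneous elements of degree `k` in the `γ v`, with coefficients in `Q`. -/

/-- Euler's identity. The subspace Q holds the coefficients that D treats as constants: the scalars
for Sym V, and 1 ⊗ Symⁿ V for Sym V ⊗ Sym V with D acting on the first factor. -/
theorem liftBaseChange_derivation {Q : Submodule ℂ T} (hD : ∀ v, D (γ v) = 1 ⊗ₜ v)
    (hQ : ∀ q ∈ Q, D q = 0) (k : ℕ) (t : T)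
    (ht : t ∈ LinearMap.range γ ^ k * Q) :
    LinearMap.liftBaseChange T γ (D t) = (k : ℂ) • t := by
  have key : ∀ s ∈ LinearMap.range γ ^ k, LinearMap.liftBaseChange T γ (D s) = (k : ℂ) • s := by
    clear ht
    intro s hs
    induction hs using Submodule.pow_induction_on_left' with
    | algebraMap r => simp
    | add x y i hx hy h1 h2 => simp only [map_add, smul_add, h1, h2]
    | mem_mul m hm i x hx h =>
      obtain ⟨v, rfl⟩ := hm
      rw [D.leibniz, map_add, map_smul, map_smul, h, hD, LinearMap.liftBaseChange_tmul]
      push_cast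
      simp only [smul_eq_mul, one_mul, add_smul, one_smul, mul_smul_comm, mul_comm x]
  induction ht using Submodule.mul_induction_on' with
  | mem_mul_mem s hs q hq =>
    rw [D.leibniz, hQ q hq, smul_zero, zero_add, map_smul, key s hs, smul_eq_mul, mul_smul_comm,
      mul_comm]
  | add x _ y _ hx hy => simp only [map_add, smul_add, hx, hy]

/-- D lowers the degree by one. Writing the degree as `j + 1 = k` makes the spanning set empty for
`k = 0`, so the same statement gives D t = 0 there. -/
theorem derivation_mem_span {Q : Submodule ℂ T} (hD : ∀ v, D (γ v) = 1 ⊗ₜ v)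
    (hQ : ∀ q ∈ Q, D q = 0) (k : ℕ) (t : T) (ht : t ∈ LinearMap.range γ ^ k * Q) :
    D t ∈ Submodule.span ℂ {y : T ⊗[ℂ] V | ∃ j, j + 1 = k ∧
      ∃ s ∈ LinearMap.range γ ^ j * Q, ∃ v : V, y = s ⊗ₜ v} := by
  have key : ∀ s ∈ LinearMap.range γ ^ k, ∀ q ∈ Q,
      q • D s ∈ Submodule.span ℂ {y : T ⊗[ℂ] V | ∃ j, j + 1 = k ∧
      ∃ s ∈ LinearMap.range γ ^ j * Q, ∃ v : V, y = s ⊗ₜ v} := by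
    clear ht
    intro s hs q hq
    induction hs using Submodule.pow_induction_on_left' with
    | algebraMap r => simp
    | add x y i hx hy h1 h2 => simp only [map_add, smul_add]; exact add_mem h1 h2
    | mem_mul m hm i x hx h =>
      obtain ⟨v, rfl⟩ := hm
      rw [D.leibniz, smul_add, hD]
      refine add_mem ?_ ?_
      · rw [smul_comm]
        generalize q • D x = y at h
        induction h using Submodule.span_induction with
        | mem y hy =>
          obtain ⟨j, rfl, s, hs, w, rfl⟩ := hy
          refine Submodule.subset_span ⟨j + 1, rfl, γ v * s, ?_, w, ?_⟩
          · rw [pow_succ', mul_assoc]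
            exact Submodule.mul_mem_mul ⟨v, rfl⟩ hs
          · rw [TensorProduct.smul_tmul', smul_eq_mul]
        | zero => simp
        | add a b _ _ ha hb => rw [smul_add]; exact add_mem ha hb
        | smul c a _ ha => rw [smul_comm]; exact Submodule.smul_mem _ c ha
      · refine Submodule.subset_span ⟨i, rfl, x * q, Submodule.mul_mem_mul hx hq, v, ?_⟩
        simp [TensorProduct.smul_tmul', mul_comm]
  induction ht using Submodule.mul_induction_on' with
  | mem_mul_mem s hs q hq =>
    rw [D.leibniz, hQ q hq, smul_zero, zero_add]
    exact key s hs q hq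
  | add x _ y _ hx hy => rw [map_add]; exact add_mem hx hy

end deRham

/-! ### Universal derivations of Sym V and of Sym V ⊗ R over R -/

section existence
variable (V : Type*) [AddCommGroup V] [Module ℂ V] (R : Type*) [CommRing R] [Algebra ℂ R]

variable {V R} in
-- The square-zero component of this algebra map is the derivation wanted below; the universal
-- property of Sym V makes it exist.
theorem exists_lift_trivSqZeroExt (γ : V →ₗ[ℂ] R) :
    ∃ F : SymmetricAlgebra ℂ V →ₐ[ℂ] TrivSqZeroExt R (R ⊗[ℂ] V),
      ∀ v, F (SymmetricAlgebra.ι ℂ V v) =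
        TrivSqZeroExt.inl (γ v) + TrivSqZeroExt.inr (1 ⊗ₜ v) :=
  ⟨SymmetricAlgebra.lift ((TrivSqZeroExt.inlAlgHom ℂ R (R ⊗[ℂ] V)).toLinearMap ∘ₗ γ +
      (TrivSqZeroExt.inrHom R (R ⊗[ℂ] V)).restrictScalars ℂ ∘ₗ TensorProduct.mk ℂ R V 1),
    fun v => by simp⟩

theorem exists_derivation_symmetricAlgebra :
    ∃ D : Derivation ℂ (SymmetricAlgebra ℂ V) (SymmetricAlgebra ℂ V ⊗[ℂ] V),
      ∀ v, D (SymmetricAlgebra.ι ℂ V v) = 1 ⊗ₜ v := by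
  obtain ⟨F, h⟩ := exists_lift_trivSqZeroExt (SymmetricAlgebra.ι ℂ V)
  have hF : (TrivSqZeroExt.fstHom ℂ _ _).comp F = AlgHom.id ℂ _ := by
    ext v; simp [h]
  obtain ⟨D, h'⟩ := exists_derivation_of_algHom F (fun t => DFunLike.congr_fun hF t)
  exact ⟨D, fun v => by rw [h', h]; simp⟩

variable {V R} in
theorem exists_lift_tensor_trivSqZeroExt {T : Type*} [CommRing T] [Algebra ℂ T] (γ : V →ₗ[ℂ] T)
    (g : R →ₐ[ℂ] T) :
    ∃ F : SymmetricAlgebra ℂ V ⊗[ℂ] R →ₐ[ℂ] TrivSqZeroExt T (T ⊗[ℂ] V),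
      (∀ v, F (SymmetricAlgebra.ι ℂ V v ⊗ₜ 1) =
        TrivSqZeroExt.inl (γ v) + TrivSqZeroExt.inr (1 ⊗ₜ v)) ∧
      ∀ r, F (1 ⊗ₜ r) = TrivSqZeroExt.inl (g r) := by
  obtain ⟨F, h⟩ := exists_lift_trivSqZeroExt γ
  exact ⟨Algebra.TensorProduct.lift F ((TrivSqZeroExt.inlAlgHom ℂ T (T ⊗[ℂ] V)).comp g)
    (fun _ _ => Commute.all _ _), fun v => by simp [h], fun r => by simp⟩

theorem exists_derivation_symmetricAlgebra_tensor :
    ∃ D : Derivation ℂ (SymmetricAlgebra ℂ V ⊗[ℂ] R) ((SymmetricAlgebra ℂ V ⊗[ℂ] R) ⊗[ℂ] V),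
      (∀ v, D (SymmetricAlgebra.ι ℂ V v ⊗ₜ 1) = 1 ⊗ₜ v) ∧ ∀ r, D (1 ⊗ₜ r) = 0 := by
  obtain ⟨F, h₁, h₂⟩ := exists_lift_tensor_trivSqZeroExt
    ((Algebra.TensorProduct.includeLeft : _ →ₐ[ℂ] SymmetricAlgebra ℂ V ⊗[ℂ] R).toLinearMap ∘ₗ
      SymmetricAlgebra.ι ℂ V) (Algebra.TensorProduct.includeRight)
  have hF : (TrivSqZeroExt.fstHom ℂ _ _).comp F = AlgHom.id ℂ _ := by
    apply Algebra.TensorProduct.ext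
    · ext v; simp [h₁]
    · ext r; simp [h₂]
  have hF' : ∀ t, (F t).fst = t := fun t => DFunLike.congr_fun hF t
  obtain ⟨D, h⟩ := exists_derivation_of_algHom (T := SymmetricAlgebra ℂ V ⊗[ℂ] R)
    (M := (SymmetricAlgebra ℂ V ⊗[ℂ] R) ⊗[ℂ] V) F hF'
  exact ⟨D, fun v => (h _).trans ((congrArg TrivSqZeroExt.snd (h₁ v)).trans (by simp)),
    fun r => (h _).trans ((congrArg TrivSqZeroExt.snd (h₂ r)).trans (by simp))⟩

end existence

/-- Over `ℂ`, the `m`-fold products of elements of a subspace are spanned by the `m`-th powers. -/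
theorem range_pow_le_span_pow {T V : Type*} [CommRing T] [Algebra ℂ T] [AddCommGroup V]
    [Module ℂ V] (γ : V →ₗ[ℂ] T) (m : ℕ) :
    LinearMap.range γ ^ m ≤ Submodule.span ℂ (Set.range fun v => γ v ^ m) := by
  induction m with
  | zero =>
    rw [pow_zero, Submodule.one_eq_span]
    exact Submodule.span_mono (by rintro _ rfl; exact ⟨0, pow_zero _⟩)
  | succ m ih =>
    rw [pow_succ']
    refine Submodule.mul_le.2 ?_
    rintro _ ⟨v, rfl⟩ s hs
    have hs' := ih hs
    clear hs
    induction hs' using Submodule.span_induction with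
    | zero => simp
    | add a b _ _ ha hb => rw [mul_add]; exact add_mem ha hb
    | smul c a _ ha => rw [mul_smul_comm]; exact Submodule.smul_mem _ c ha
    | mem s hs =>
      obtain ⟨u, rfl⟩ := hs
      change γ v * γ u ^ m ∈ _
      -- Separate v uᵐ from the span by a linear functional φ. Then t ↦ φ((t v + u)ᵐ⁺¹) is a
      -- polynomial vanishing at every t, while its linear coefficient is (m + 1) φ(v uᵐ), which is
      -- nonzero in characteristic zero.
      by_contra hne
      obtain ⟨φ, hφ, hP⟩ := Submodule.exists_le_ker_of_notMem hne
      let P : Polynomial ℂ := ∑ k ∈ Finset.range (m + 1 + 1), Polynomial.C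
        (φ (γ v ^ k * γ u ^ (m + 1 - k) * ((m + 1).choose k : T))) * Polynomial.X ^ k
      have hP0 : P = 0 := by
        refine Polynomial.funext fun t => ?_
        have h : φ (γ (t • v + u) ^ (m + 1)) = 0 := hP (Submodule.subset_span ⟨t • v + u, rfl⟩)
        rw [map_add, map_smul, add_pow, map_sum] at h
        rw [Polynomial.eval_zero, ← h, Polynomial.eval_finsetSum]
        refine Finset.sum_congr rfl fun k _ => ?_
        rw [smul_pow, smul_mul_assoc, smul_mul_assoc, map_smul]
        simp only [Polynomial.eval_mul, Polynomial.eval_C, Polynomial.eval_pow, Polynomial.eval_X,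
          smul_eq_mul]
        exact mul_comm _ _
      have h1 : P.coeff 1 = 0 := by rw [hP0, Polynomial.coeff_zero]
      simp only [P, Polynomial.finsetSum_coeff, Polynomial.coeff_C_mul_X_pow] at h1
      rw [Finset.sum_ite_eq, if_pos (by simp)] at h1
      have h2 : γ v ^ 1 * γ u ^ (m + 1 - 1) * ((m + 1).choose 1 : T) =
          ((m + 1 : ℕ) : ℂ) • (γ v * γ u ^ m) := by
        rw [pow_one, Nat.add_sub_cancel, Nat.choose_one_right, Nat.cast_smul_eq_nsmul,
          nsmul_eq_mul, mul_comm]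
      rw [h2, map_smul, smul_eq_mul, mul_eq_zero] at h1
      exact h1.elim (Nat.cast_ne_zero.2 m.succ_ne_zero) hφ

/-! ### Exactness of the Koszul complex of Sym V -/

section koszul
variable {V : Type u} [AddCommGroup V] [Module ℂ V]

theorem symPow_natCast (n : ℕ) :
    symPow V (n : ℤ) = LinearMap.range (SymmetricAlgebra.ι ℂ V) ^ n := by
  simp [symPow]

theorem tmul_mem_range_incl {i n : ℕ} {p : SymmetricAlgebra ℂ V} {x : ExteriorAlgebra ℂ V}
    (hp : p ∈ LinearMap.range (SymmetricAlgebra.ι ℂ V) ^ n) (hx : x ∈ ⋀[ℂ]^i V) :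
    p ⊗ₜ x ∈ LinearMap.range (incl V V i n) :=
  ⟨⟨x, hx⟩ ⊗ₜ ⟨p, by rwa [symPow_natCast]⟩, rfl⟩

/-- Reduces claims about ⋀ⁱV ⊗ SymⁿV inside the ambient algebra to pure tensors; linear identities
are handled by taking N to be a kernel or a preimage. -/
theorem range_incl_le {i n : ℕ} {N : Submodule ℂ (SymmetricAlgebra ℂ V ⊗[ℂ] ExteriorAlgebra ℂ V)}
    (h : ∀ p ∈ LinearMap.range (SymmetricAlgebra.ι ℂ V) ^ n, ∀ x ∈ ⋀[ℂ]^i V, p ⊗ₜ x ∈ N) :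
    LinearMap.range (incl V V i n) ≤ N := by
  rintro _ ⟨z, rfl⟩
  induction z using TensorProduct.induction_on with
  | zero => simp
  | add a b ha hb => rw [map_add]; exact add_mem ha hb
  | tmul x p => exact h p (by rw [← symPow_natCast]; exact p.2) x x.2

theorem ι_mul_mem {i : ℕ} (v : V) {x : ExteriorAlgebra ℂ V} (hx : x ∈ ⋀[ℂ]^i V) :
    ExteriorAlgebra.ι ℂ v * x ∈ ⋀[ℂ]^(i + 1) V := by
  change _ ∈ LinearMap.range (ExteriorAlgebra.ι ℂ (M := V)) ^ (i + 1)
  rw [pow_succ']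
  exact Submodule.mul_mem_mul ⟨v, rfl⟩ hx

theorem koszulDelta_mem {i n : ℕ} {z : SymmetricAlgebra ℂ V ⊗[ℂ] ExteriorAlgebra ℂ V}
    (hz : z ∈ LinearMap.range (incl V V (i + 1) n)) :
    koszulDelta V z ∈ LinearMap.range (incl V V i (n + 1 : ℕ)) := by
  refine range_incl_le (N := (LinearMap.range (incl V V i (n + 1 : ℕ))).comap (koszulDelta V))
    (fun p hp x hx => ?_) hz
  rw [Submodule.mem_comap, koszulDelta, LinearMap.restrictScalars_apply, koszul,
    LinearMap.liftBaseChange_tmul, LinearMap.comp_apply]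
  obtain ⟨y, hy⟩ := comul_mem V i x hx
  rw [← hy]
  clear hy
  induction y with
  | zero => simp
  | add a b ha hb => rw [map_add, map_add, smul_add]; exact add_mem ha hb
  | tmul w x' =>
    rw [LinearMap.lTensor_tmul, LinearMap.rTensor_tmul, TensorProduct.smul_tmul']
    exact tmul_mem_range_incl (by rw [pow_succ]; exact Submodule.mul_mem_mul hp ⟨w, rfl⟩) x'.2

variable {D : Derivation ℂ (SymmetricAlgebra ℂ V) (SymmetricAlgebra ℂ V ⊗[ℂ] V)}
  (hD : ∀ v, D (SymmetricAlgebra.ι ℂ V v) = 1 ⊗ₜ v)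

theorem derivation_apply_of_mem_one {T M : Type*} [CommRing T] [Algebra ℂ T] [AddCommGroup M]
    [Module T M] [Module ℂ M] (D : Derivation ℂ T M) (q : T)
    (hq : q ∈ (1 : Submodule ℂ T)) : D q = 0 := by
  obtain ⟨r, rfl⟩ := Submodule.mem_one.1 hq
  exact D.map_algebraMap r

include hD

theorem deRham_mem {i n : ℕ} {z : SymmetricAlgebra ℂ V ⊗[ℂ] ExteriorAlgebra ℂ V}
    (hz : z ∈ LinearMap.range (incl V V i (n + 1 : ℕ))) :
    deRham D z ∈ LinearMap.range (incl V V (i + 1) n) := by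
  refine range_incl_le (N := (LinearMap.range (incl V V (i + 1) n)).comap (deRham D))
    (fun p hp x hx => ?_) hz
  rw [Submodule.mem_comap, deRham_tmul]
  have h := derivation_mem_span hD (derivation_apply_of_mem_one D) (n + 1) p (by rwa [mul_one])
  generalize D p = y at h
  induction h using Submodule.span_induction with
  | zero => simp
  | add a b _ _ ha hb => rw [map_add, add_mul]; exact add_mem ha hb
  | smul c a _ ha =>
    rw [LinearMap.map_smul_of_tower, smul_mul_assoc]; exact Submodule.smul_mem _ c ha
  | mem y hy =>
    obtain ⟨j, hj, s, hs, w, rfl⟩ := hy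
    obtain rfl : j = n := by omega
    rw [mul_one] at hs
    rw [oneForm_tmul, Algebra.TensorProduct.tmul_mul_tmul, mul_one]
    exact tmul_mem_range_incl hs (ι_mul_mem w hx)

theorem koszulDelta_deRham_add {i n : ℕ} {z : SymmetricAlgebra ℂ V ⊗[ℂ] ExteriorAlgebra ℂ V}
    (hz : z ∈ LinearMap.range (incl V V i n)) :
    koszulDelta V (deRham D z) + deRham D (koszulDelta V z) = ((n : ℂ) + i) • z := by
  have h := range_incl_le (N := LinearMap.ker (koszulDelta V ∘ₗ deRham D +
    deRham D ∘ₗ koszulDelta V - ((n : ℂ) + i) • LinearMap.id)) (fun p hp x hx => ?_) hz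
  · exact sub_eq_zero.1 h
  · have := koszul_deRham_add hD n p (liftBaseChange_derivation hD (derivation_apply_of_mem_one D) n p
      (by rwa [mul_one])) i x hx
    exact sub_eq_zero.2 this

omit hD
/-- Exactness of the Koszul complex in positive symmetric degree. -/
theorem exists_koszulDelta_eq {i n : ℕ} {z : SymmetricAlgebra ℂ V ⊗[ℂ] ExteriorAlgebra ℂ V}
    (hz : z ∈ LinearMap.range (incl V V i (n + 1 : ℕ))) (hz0 : koszulDelta V z = 0) :
    ∃ y ∈ LinearMap.range (incl V V (i + 1) n), koszulDelta V y = z := by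
  obtain ⟨D, hD⟩ := exists_derivation_symmetricAlgebra V
  have h := koszulDelta_deRham_add hD hz
  rw [hz0, map_zero, add_zero] at h
  -- The total degree is invertible because the symmetric degree is positive. The preimage of z is
  -- then d z divided by it.
  have hne : (((n + 1 : ℕ) : ℂ) + i) ≠ 0 := by
    have : ((n + 1 + i : ℕ) : ℂ) ≠ 0 := Nat.cast_ne_zero.2 (by omega)
    exact_mod_cast this
  refine ⟨(((n + 1 : ℕ) : ℂ) + i)⁻¹ • deRham D z, Submodule.smul_mem _ _ (deRham_mem hD hz), ?_⟩
  rw [map_smul, h, smul_smul, inv_mul_cancel₀ hne, one_smul]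

end koszul

/-! ### Surjectivity of ψ -/

section psi
variable {V : Type u} [AddCommGroup V] [Module ℂ V]

theorem psiAmbient_tmul' (x : ExteriorAlgebra ℂ (⋀[ℂ]^2 V)) (p : SymmetricAlgebra ℂ V) :
    psiAmbient V (x ⊗ₜ p) = p • koszulMul V (ExteriorAlgebra.map (wedgeIncl V) x) := by
  rw [psiAmbient_tmul]
  generalize koszulMul V (ExteriorAlgebra.map (wedgeIncl V) x) = y
  induction y with
  | zero => simp
  | add a b ha hb => rw [add_mul, smul_add, ha, hb]
  | tmul s x => simp [TensorProduct.smul_tmul', mul_comm]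

theorem tensorToKoszul_wedge (u v : V) (y : SymmetricAlgebra ℂ V ⊗[ℂ] ExteriorAlgebra ℂ V) :
    tensorToKoszul V (wedgeIncl V (exteriorPower.ιMulti ℂ 2 ![u, v])) * y =
      SymmetricAlgebra.ι ℂ V v • ((1 ⊗ₜ ExteriorAlgebra.ι ℂ u) * y) -
      SymmetricAlgebra.ι ℂ V u • ((1 ⊗ₜ ExteriorAlgebra.ι ℂ v) * y) := by
  rw [wedgeIncl_apply, map_sub, sub_mul]
  simp only [Matrix.cons_val_zero, Matrix.cons_val_one, tensorToKoszul_tmul, ← smul_mul_assoc,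
    TensorProduct.smul_tmul', smul_eq_mul, mul_one]

theorem koszulDelta_ι_mul (v : V) (y : SymmetricAlgebra ℂ V ⊗[ℂ] ExteriorAlgebra ℂ V) :
    koszulDelta V ((1 ⊗ₜ ExteriorAlgebra.ι ℂ v) * y) =
      SymmetricAlgebra.ι ℂ V v • y - (1 ⊗ₜ ExteriorAlgebra.ι ℂ v) * koszulDelta V y :=
  koszul_ι_mul _ v y

theorem koszulDelta_smul (s : SymmetricAlgebra ℂ V)
    (y : SymmetricAlgebra ℂ V ⊗[ℂ] ExteriorAlgebra ℂ V) :
    koszulDelta V (s • y) = s • koszulDelta V y :=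
  (koszul (SymmetricAlgebra.ι ℂ V)).map_smul s y

theorem ι_mul_ι_mul (u v : V) (y : SymmetricAlgebra ℂ V ⊗[ℂ] ExteriorAlgebra ℂ V) :
    (1 ⊗ₜ[ℂ] ExteriorAlgebra.ι ℂ u) * ((1 ⊗ₜ ExteriorAlgebra.ι ℂ v) * y) =
      -((1 ⊗ₜ ExteriorAlgebra.ι ℂ v) * ((1 ⊗ₜ ExteriorAlgebra.ι ℂ u) * y)) := by
  have h := oneForm_mul_ι ((1 : SymmetricAlgebra ℂ V) ⊗ₜ[ℂ] u) v y
  rwa [oneForm_tmul] at h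

/-- Expand δ by the antiderivation rule and use u ∧ u = 0. This is the inductive step below: one
more bivector u ∧ v inserts v after u and adds one power of u, at the cost of a sign. -/
theorem tensorToKoszul_wedge_mul_koszulDelta (u v : V)
    (y : SymmetricAlgebra ℂ V ⊗[ℂ] ExteriorAlgebra ℂ V) :
    tensorToKoszul V (wedgeIncl V (exteriorPower.ιMulti ℂ 2 ![u, v])) *
        koszulDelta V ((1 ⊗ₜ ExteriorAlgebra.ι ℂ u) * y) =
      -(SymmetricAlgebra.ι ℂ V u • koszulDelta V
        ((1 ⊗ₜ ExteriorAlgebra.ι ℂ u) * ((1 ⊗ₜ ExteriorAlgebra.ι ℂ v) * y))) := by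
  have hsq : ∀ y : SymmetricAlgebra ℂ V ⊗[ℂ] ExteriorAlgebra ℂ V,
      (1 ⊗ₜ[ℂ] ExteriorAlgebra.ι ℂ u) * ((1 ⊗ₜ ExteriorAlgebra.ι ℂ u) * y) = 0 := fun y => by
    rw [← mul_assoc]; simp
  rw [tensorToKoszul_wedge]
  simp only [koszulDelta_ι_mul, mul_sub, hsq, sub_zero, mul_smul_comm, smul_sub, smul_smul,
    mul_comm (SymmetricAlgebra.ι ℂ V v)]
  rw [ι_mul_ι_mul v u]
  simp only [smul_neg]
  abel

/-- `(∏ⱼ u ∧ vⱼ) ∈ ⋀ʲ⁺¹(⋀²V)` is mapped to `± uʲ δ (u ∧ v₀ ∧ ⋯ ∧ vⱼ)`. -/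
theorem exists_koszulMul_eq (u : V) (j : ℕ) (x : ExteriorAlgebra ℂ V) (hx : x ∈ ⋀[ℂ]^(j + 1) V) :
    ∃ y ∈ ⋀[ℂ]^(j + 1) (⋀[ℂ]^2 V), koszulMul V (ExteriorAlgebra.map (wedgeIncl V) y) =
      SymmetricAlgebra.ι ℂ V u ^ j • koszulDelta V (1 ⊗ₜ (ExteriorAlgebra.ι ℂ u * x)) := by
  have hone : ∀ a b : ExteriorAlgebra ℂ V, (1 : SymmetricAlgebra ℂ V) ⊗ₜ[ℂ] (a * b) =
      (1 ⊗ₜ a) * (1 ⊗ₜ b) := fun a b => by simp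
  have hm : ∀ (w : ⋀[ℂ]^2 V) (y : ExteriorAlgebra ℂ (⋀[ℂ]^2 V)),
      koszulMul V (ExteriorAlgebra.map (wedgeIncl V) (ExteriorAlgebra.ι ℂ w * y)) =
      tensorToKoszul V (wedgeIncl V w) * koszulMul V (ExteriorAlgebra.map (wedgeIncl V) y) := by
    intro w y
    rw [map_mul, map_mul, ExteriorAlgebra.map_apply_ι, koszulMul, ExteriorAlgebra.lift_ι_apply]
  -- The formula starts in exterior degree 1, where the exponent of u is 0. In degree 0 the
  -- predicate only records that x is a scalar, which is what the passage to degree 1 needs.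
  have key := exteriorPower_induction (V := V)
    (C := fun i x => match i with
      | 0 => ∃ c : ℂ, x = c • 1
      | j + 1 => ∃ y ∈ ⋀[ℂ]^(j + 1) (⋀[ℂ]^2 V),
        koszulMul V (ExteriorAlgebra.map (wedgeIncl V) y) =
        SymmetricAlgebra.ι ℂ V u ^ j • koszulDelta V (1 ⊗ₜ (ExteriorAlgebra.ι ℂ u * x)))
    ⟨1, (one_smul _ _).symm⟩ ?_ ?_ ?_ (j + 1) x hx
  · exact key
  · intro i x y h1 h2
    cases i with
    | zero =>
      obtain ⟨c, rfl⟩ := h1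
      obtain ⟨c', rfl⟩ := h2
      exact ⟨c + c', (add_smul _ _ _).symm⟩
    | succ i =>
      obtain ⟨a, ha, ha'⟩ := h1
      obtain ⟨b, hb, hb'⟩ := h2
      exact ⟨a + b, add_mem ha hb, by
        simp only [map_add, ha', hb', mul_add, TensorProduct.tmul_add, smul_add]⟩
  · intro i c x h1
    cases i with
    | zero =>
      obtain ⟨c', rfl⟩ := h1
      exact ⟨c * c', by rw [smul_smul]⟩
    | succ i =>
      obtain ⟨a, ha, ha'⟩ := h1
      exact ⟨c • a, Submodule.smul_mem _ c ha, by
        simp only [map_smul, ha', mul_smul_comm, TensorProduct.tmul_smul]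
        rw [smul_comm]⟩
  · intro i v x hx h
    cases i with
    | zero =>
      obtain ⟨c, rfl⟩ := h
      -- The sign reconciles two conventions: the bivector u ∧ v maps to v·u - u·v (scalar first,
      -- exterior factor second), whereas δ(u ∧ v) = u·v - v·u.
      refine ⟨-(ExteriorAlgebra.ι ℂ (exteriorPower.ιMulti ℂ 2 ![u, v]) * (c • 1)),
        neg_mem (ι_mul_mem _ (Submodule.smul_mem _ c (by simp))), ?_⟩
      have h0 : koszulDelta V 1 = 0 := koszul_tmul_one _ _
      have h1 : koszulDelta V (1 ⊗ₜ ExteriorAlgebra.ι ℂ v) = SymmetricAlgebra.ι ℂ V v • 1 := by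
        have h := koszulDelta_ι_mul v 1
        rwa [mul_one, h0, mul_zero, sub_zero] at h
      have h2 := tensorToKoszul_wedge u v 1
      rw [mul_one, mul_one, mul_one] at h2
      rw [mul_smul_comm, mul_one, mul_smul_comm, mul_smul_comm, mul_one, TensorProduct.tmul_smul,
        map_neg, map_neg, map_smul, map_smul, map_smul, pow_zero, one_smul, hone,
        koszulDelta_ι_mul, h1, ExteriorAlgebra.map_apply_ι, koszulMul,
        ExteriorAlgebra.lift_ι_apply, h2, mul_smul_comm, mul_one, smul_sub, smul_sub,
        neg_sub]
    | succ i =>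
      obtain ⟨y, hy, hy'⟩ := h
      refine ⟨-(ExteriorAlgebra.ι ℂ (exteriorPower.ιMulti ℂ 2 ![u, v]) * y),
        neg_mem (ι_mul_mem _ hy), ?_⟩
      rw [map_neg, map_neg, hm, hy', mul_smul_comm, hone, tensorToKoszul_wedge_mul_koszulDelta,
        hone, hone, smul_neg, neg_neg, smul_smul, pow_succ]

/-- By polarization the symmetric part of w may be taken to be uᵏ⁺¹, whose de Rham differential is
(k+1) uᵏ ⊗ (u ∧ x); `exists_koszulMul_eq` then applies. Equal symmetric and exterior degrees leave
exactly the power uᵏ which that lemma requires, and p passes through because δ is Sym V-linear. -/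
theorem smul_koszulDelta_deRham_mem
    {D : Derivation ℂ (SymmetricAlgebra ℂ V) (SymmetricAlgebra ℂ V ⊗[ℂ] V)}
    (hD : ∀ v, D (SymmetricAlgebra.ι ℂ V v) = 1 ⊗ₜ v) (k m : ℕ)
    {p : SymmetricAlgebra ℂ V} (hp : p ∈ symPow V m)
    {w : SymmetricAlgebra ℂ V ⊗[ℂ] ExteriorAlgebra ℂ V}
    (hw : w ∈ LinearMap.range (incl V V (k + 1) (k + 1 : ℕ))) :
    p • koszulDelta V (deRham D w) ∈ LinearMap.range (psiAmbient V ∘ₗ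
      TensorProduct.map (⋀[ℂ]^(k + 1) (⋀[ℂ]^2 V)).subtype (symPow V m).subtype) := by
  refine range_incl_le (N := (LinearMap.range (psiAmbient V ∘ₗ
      TensorProduct.map (⋀[ℂ]^(k + 1) (⋀[ℂ]^2 V)).subtype (symPow V m).subtype)).comap
      ((LinearMap.lsmul (SymmetricAlgebra ℂ V) _ p).restrictScalars ℂ ∘ₗ koszulDelta V ∘ₗ
        deRham D)) (fun q hq x hx => ?_) hw
  replace hq := range_pow_le_span_pow _ _ hq
  change p • koszulDelta V (deRham D (q ⊗ₜ x)) ∈ LinearMap.range (psiAmbient V ∘ₗ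
      TensorProduct.map (⋀[ℂ]^(k + 1) (⋀[ℂ]^2 V)).subtype (symPow V m).subtype)
  induction hq using Submodule.span_induction with
  | zero => simp
  | add a b _ _ ha hb =>
    rw [TensorProduct.add_tmul, map_add, map_add, smul_add]; exact add_mem ha hb
  | smul c a _ ha =>
    rw [← TensorProduct.smul_tmul', map_smul, map_smul, smul_comm]; exact Submodule.smul_mem _ c ha
  | mem q hq =>
    obtain ⟨u, rfl⟩ := hq
    obtain ⟨y, hy, hy'⟩ := exists_koszulMul_eq u k x hx
    have h : deRham D ((SymmetricAlgebra.ι ℂ V u ^ (k + 1)) ⊗ₜ x) = ((k + 1 : ℕ) : ℂ) •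
        SymmetricAlgebra.ι ℂ V u ^ k •
          ((1 : SymmetricAlgebra ℂ V) ⊗ₜ[ℂ] (ExteriorAlgebra.ι ℂ u * x)) := by
      rw [deRham_tmul, D.leibniz_pow, Nat.add_sub_cancel, hD, Nat.cast_smul_eq_nsmul, map_nsmul,
        map_smul, oneForm_tmul, smul_mul_assoc, smul_mul_assoc,
        Algebra.TensorProduct.tmul_mul_tmul, one_mul]
    rw [h, map_smul, koszulDelta_smul, ← hy', smul_comm, ← psiAmbient_tmul']
    exact Submodule.smul_mem _ _ ⟨⟨y, hy⟩ ⊗ₜ ⟨p, hp⟩, rfl⟩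

/-- The m surplus symmetric factors are split off as p. The rest, w = δ(q ⊗ x), is closed of
bidegree (k+1, k+1), so the homotopy formula rewrites it as δ d w divided by 2(k+1). -/
theorem koszulDelta_mem_range_psiAmbient (k m : ℕ)
    {y : SymmetricAlgebra ℂ V ⊗[ℂ] ExteriorAlgebra ℂ V}
    (hy : y ∈ LinearMap.range (incl V V (k + 2) (m + k : ℕ))) :
    koszulDelta V y ∈ LinearMap.range (psiAmbient V ∘ₗ
      TensorProduct.map (⋀[ℂ]^(k + 1) (⋀[ℂ]^2 V)).subtype (symPow V m).subtype) := by
  obtain ⟨D, hD⟩ := exists_derivation_symmetricAlgebra V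
  refine range_incl_le (N := (LinearMap.range (psiAmbient V ∘ₗ
      TensorProduct.map (⋀[ℂ]^(k + 1) (⋀[ℂ]^2 V)).subtype (symPow V m).subtype)).comap
      (koszulDelta V)) (fun r hr x hx => ?_) hy
  rw [Submodule.mem_comap]
  rw [pow_add] at hr
  induction hr using Submodule.mul_induction_on' with
  | add a _ b _ ha hb => rw [TensorProduct.add_tmul, map_add]; exact add_mem ha hb
  | mem_mul_mem p hp q hq =>
    have hw := koszulDelta_mem (tmul_mem_range_incl hq hx)
    have hww : koszulDelta V (koszulDelta V (q ⊗ₜ x)) = 0 := koszul_koszul _ _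
    have h := koszulDelta_deRham_add hD hw
    rw [hww, map_zero, add_zero] at h
    have hne : (((k + 1 : ℕ) : ℂ) + (k + 1 : ℕ)) ≠ 0 := by
      have : ((k + 1 + (k + 1) : ℕ) : ℂ) ≠ 0 := Nat.cast_ne_zero.2 (by omega)
      exact_mod_cast this
    have hpq : (p * q) ⊗ₜ[ℂ] x = p • (q ⊗ₜ[ℂ] x) := by
      rw [TensorProduct.smul_tmul', smul_eq_mul]
    have hmem := smul_koszulDelta_deRham_mem hD k m (by rwa [symPow_natCast]) hw (p := p)
    rw [h, smul_comm] at hmem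
    rw [hpq, koszulDelta_smul]
    exact (Submodule.smul_mem_iff _ hne).1 hmem

theorem incl_hook_mem_range_psiAmbient (n i : ℕ) (hi : i ≤ n) (z : hook V n i) :
    incl V V i n z ∈ LinearMap.range (psiAmbient V ∘ₗ
      TensorProduct.map (⋀[ℂ]^i (⋀[ℂ]^2 V)).subtype (symPow V ((n : ℤ) - (i : ℤ))).subtype) := by
  -- The bound i ≤ n makes n - i a natural number m; otherwise Symⁿ⁻ⁱ would be zero.
  obtain ⟨m, rfl⟩ := Nat.exists_eq_add_of_le' hi
  have hm : ((m + i : ℕ) : ℤ) - (i : ℤ) = m := by push_cast; ring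
  rw [hm]
  cases i with
  | zero =>
    refine range_incl_le (fun p hp x hx => ?_) (LinearMap.mem_range_self (incl V V 0 (m + 0 : ℕ)) z.1)
    obtain ⟨c, rfl⟩ : x ∈ (1 : Submodule ℂ (ExteriorAlgebra ℂ V)) := hx
    refine ⟨⟨1, by simp⟩ ⊗ₜ ⟨c • p, by rw [symPow_natCast]; exact Submodule.smul_mem _ c hp⟩, ?_⟩
    rw [LinearMap.comp_apply, TensorProduct.map_tmul, Submodule.subtype_apply,
      Submodule.subtype_apply, psiAmbient_tmul', map_one, map_one, Algebra.TensorProduct.one_def,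
      TensorProduct.smul_tmul', smul_eq_mul, mul_one, TensorProduct.smul_tmul]
    rfl
  | succ k =>
    -- The symmetric degree m + k + 1 is positive, so the hook element is a δ-boundary.
    obtain ⟨y, hy, hy'⟩ := exists_koszulDelta_eq (n := m + k)
      (LinearMap.mem_range_self (incl V V (k + 1) (m + k + 1 : ℕ)) z.1) z.2
    rw [show incl V V (k + 1) ((m + (k + 1) : ℕ) : ℤ) z = koszulDelta V y from hy'.symm]
    exact koszulDelta_mem_range_psiAmbient k m hy

theorem incl_psiFull (n i : ℕ)
    (y : (⋀[ℂ]^i (⋀[ℂ]^2 V)) ⊗[ℂ] (symPow V ((n : ℤ) - (i : ℤ)))) :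
    incl V V i n (psiFull V n i y) = psiAmbient V (TensorProduct.map
      (⋀[ℂ]^i (⋀[ℂ]^2 V)).subtype (symPow V ((n : ℤ) - (i : ℤ))).subtype y) :=
  LinearMap.codRestrictOfInjective_comp_apply _ (incl V V i n ∘ₗ (hook V n i).subtype) _ _ y

theorem psiFull_surjective (n i : ℕ) (hi : i ≤ n) : Function.Surjective (psiFull V n i) := by
  intro z
  obtain ⟨y, hy⟩ := incl_hook_mem_range_psiAmbient n i hi z
  refine ⟨y, Subtype.ext (incl_injective V V i n ?_)⟩
  rw [incl_psiFull]
  exact hy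

end psi

theorem koszul_koszul_add_koszul_koszul {T W : Type*} [CommRing T] [Algebra ℂ T] [AddCommGroup W]
    [Module ℂ W] (g h : W →ₗ[ℂ] T) (y : T ⊗[ℂ] ExteriorAlgebra ℂ W) :
    koszul g (koszul h y) + koszul h (koszul g y) = 0 := by
  rw [koszul_anticomm, neg_add_cancel]

/-! ### The double Koszul complex on Sym V ⊗ Sym V ⊗ ⋀V -/

section resolution
variable (V : Type u) [AddCommGroup V] [Module ℂ V]

/-- The span of `(s ⊗ p) ⊗ x` with `s ∈ Symᵏ V`, `p ∈ Symⁿ V` and `x ∈ ⋀ⁱV`. -/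
def triDegree (k n i : ℕ) : Submodule ℂ
    ((SymmetricAlgebra ℂ V ⊗[ℂ] SymmetricAlgebra ℂ V) ⊗[ℂ] ExteriorAlgebra ℂ V) :=
  Submodule.span ℂ {z | ∃ s ∈ LinearMap.range (SymmetricAlgebra.ι ℂ V) ^ k,
    ∃ p ∈ LinearMap.range (SymmetricAlgebra.ι ℂ V) ^ n, ∃ x ∈ ⋀[ℂ]^i V, z = (s ⊗ₜ p) ⊗ₜ x}

/-- The sum of the `triDegree V k n i` with `k < a`. -/
def triFiltration (n i : ℕ) : ℕ → Submodule ℂ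
    ((SymmetricAlgebra ℂ V ⊗[ℂ] SymmetricAlgebra ℂ V) ⊗[ℂ] ExteriorAlgebra ℂ V)
  | 0 => ⊥
  | a + 1 => triFiltration n i a ⊔ triDegree V a n i

theorem triFiltration_mono (n i : ℕ) : Monotone (triFiltration V n i) :=
  monotone_nat_of_le_succ fun _ => le_sup_left

theorem triDegree_le_triFiltration {k a : ℕ} (n i : ℕ) (h : k < a) :
    triDegree V k n i ≤ triFiltration V n i a :=
  le_trans (b := triFiltration V n i (k + 1)) le_sup_right (triFiltration_mono V n i h)

theorem span_range_ι_pow :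
    Submodule.span ℂ {s : SymmetricAlgebra ℂ V | ∃ k : ℕ,
      s ∈ LinearMap.range (SymmetricAlgebra.ι ℂ V) ^ k} = ⊤ := by
  have h : Algebra.adjoin ℂ (Set.range (SymmetricAlgebra.ι ℂ V)) = ⊤ := by
    refine eq_top_iff.2 fun s _ => ?_
    induction s using SymmetricAlgebra.induction with
    | algebraMap r => exact Subalgebra.algebraMap_mem _ r
    | ι v => exact Algebra.subset_adjoin ⟨v, rfl⟩
    | mul a b ha hb => exact mul_mem (ha trivial) (hb trivial)
    | add a b ha hb => exact add_mem (ha trivial) (hb trivial)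
  rw [eq_top_iff, ← Algebra.top_toSubmodule, ← h, Algebra.adjoin_eq_span]
  refine Submodule.span_mono fun s hs => ?_
  induction hs using Submonoid.closure_induction with
  | mem s hs => exact ⟨1, by rw [pow_one]; exact hs⟩
  | one => exact ⟨0, by rw [pow_zero]; exact Submodule.one_le.1 le_rfl⟩
  | mul a b _ _ ha hb =>
    obtain ⟨k, hk⟩ := ha
    obtain ⟨l, hl⟩ := hb
    exact ⟨k + l, by rw [pow_add]; exact Submodule.mul_mem_mul hk hl⟩

variable {V}

/-- The filtration is exhaustive, so induction on the bound a for the first degree can replace a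
splitting into homogeneous components. -/
theorem exists_mem_triFiltration {n i : ℕ}
    (y : SymmetricAlgebra ℂ V ⊗[ℂ] ((⋀[ℂ]^i V) ⊗[ℂ] (symPow V (n : ℤ)))) :
    ∃ a, inclBase V V (SymmetricAlgebra ℂ V) i n y ∈ triFiltration V n i a := by
  have hadd : ∀ z w, (∃ a, z ∈ triFiltration V n i a) → (∃ a, w ∈ triFiltration V n i a) →
      ∃ a, z + w ∈ triFiltration V n i a := by
    rintro z w ⟨a, ha⟩ ⟨b, hb⟩
    exact ⟨max a b, add_mem (triFiltration_mono V n i (le_max_left a b) ha)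
      (triFiltration_mono V n i (le_max_right a b) hb)⟩
  induction y with
  | zero => exact ⟨0, by simp⟩
  | add a b ha hb => rw [map_add]; exact hadd _ _ ha hb
  | tmul s t =>
    induction t with
    | zero => exact ⟨0, by simp⟩
    | add a b ha hb => rw [TensorProduct.tmul_add, map_add]; exact hadd _ _ ha hb
    | tmul x p =>
      rw [inclBase_tmul]
      have hs : s ∈ Submodule.span ℂ {s : SymmetricAlgebra ℂ V | ∃ k : ℕ,
          s ∈ LinearMap.range (SymmetricAlgebra.ι ℂ V) ^ k} := by
        rw [span_range_ι_pow]; trivial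
      induction hs using Submodule.span_induction with
      | zero => exact ⟨0, by simp⟩
      | add a b _ _ ha hb =>
        rw [TensorProduct.add_tmul, TensorProduct.add_tmul]; exact hadd _ _ ha hb
      | smul c s _ h =>
        obtain ⟨a, ha⟩ := h
        refine ⟨a, ?_⟩
        rw [← TensorProduct.smul_tmul', ← TensorProduct.smul_tmul']
        exact Submodule.smul_mem _ c ha
      | mem s hs =>
        obtain ⟨k, hk⟩ := hs
        exact ⟨k + 1, triDegree_le_triFiltration V n i k.lt_succ_self (Submodule.subset_span
          ⟨s, hk, p, by rw [← symPow_natCast]; exact p.2, x, x.2, rfl⟩)⟩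

theorem triDegree_le_range (k n i : ℕ) : triDegree V k n i ≤
    (LinearMap.range (inclBase V V (SymmetricAlgebra ℂ V) i n)).restrictScalars ℂ := by
  refine Submodule.span_le.2 ?_
  rintro _ ⟨s, _, p, hp, x, hx, rfl⟩
  exact ⟨s ⊗ₜ (⟨x, hx⟩ ⊗ₜ ⟨p, by rwa [symPow_natCast]⟩), rfl⟩

theorem triFiltration_le_range (n i a : ℕ) : triFiltration V n i a ≤
    (LinearMap.range (inclBase V V (SymmetricAlgebra ℂ V) i n)).restrictScalars ℂ := by
  induction a with
  | zero => exact bot_le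
  | succ a ih => exact sup_le ih (triDegree_le_range a n i)

variable (V) in
/-- The Koszul differential in the first symmetric factor. -/
noncomputable def koszulFst : (SymmetricAlgebra ℂ V ⊗[ℂ] SymmetricAlgebra ℂ V) ⊗[ℂ]
    ExteriorAlgebra ℂ V →ₗ[ℂ] (SymmetricAlgebra ℂ V ⊗[ℂ] SymmetricAlgebra ℂ V) ⊗[ℂ]
    ExteriorAlgebra ℂ V :=
  (koszul (coeffForm (SymmetricAlgebra.ι ℂ V))).restrictScalars ℂ

variable (V) in
/-- The Koszul differential in the second symmetric factor. -/
noncomputable def koszulSnd : (SymmetricAlgebra ℂ V ⊗[ℂ] SymmetricAlgebra ℂ V) ⊗[ℂ]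
    ExteriorAlgebra ℂ V →ₗ[ℂ] (SymmetricAlgebra ℂ V ⊗[ℂ] SymmetricAlgebra ℂ V) ⊗[ℂ]
    ExteriorAlgebra ℂ V :=
  (koszul (TensorProduct.mk ℂ (SymmetricAlgebra ℂ V) (SymmetricAlgebra ℂ V) 1 ∘ₗ
    SymmetricAlgebra.ι ℂ V)).restrictScalars ℂ

theorem koszulFst_koszulFst (z : (SymmetricAlgebra ℂ V ⊗[ℂ] SymmetricAlgebra ℂ V) ⊗[ℂ]
    ExteriorAlgebra ℂ V) : koszulFst V (koszulFst V z) = 0 := koszul_koszul _ z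

theorem koszulSnd_koszulSnd (z : (SymmetricAlgebra ℂ V ⊗[ℂ] SymmetricAlgebra ℂ V) ⊗[ℂ]
    ExteriorAlgebra ℂ V) : koszulSnd V (koszulSnd V z) = 0 := koszul_koszul _ z

theorem koszulFst_koszulSnd (z : (SymmetricAlgebra ℂ V ⊗[ℂ] SymmetricAlgebra ℂ V) ⊗[ℂ]
    ExteriorAlgebra ℂ V) : koszulFst V (koszulSnd V z) + koszulSnd V (koszulFst V z) = 0 :=
  koszul_koszul_add_koszul_koszul _ _ z

theorem koszulSnd_mem_triDegree {k n i : ℕ} {z} (hz : z ∈ triDegree V k n (i + 1)) :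
    koszulSnd V z ∈ triDegree V k (n + 1) i := by
  induction hz using Submodule.span_induction with
  | zero => simp
  | add a b _ _ ha hb => rw [map_add]; exact add_mem ha hb
  | smul c a _ ha => rw [map_smul]; exact Submodule.smul_mem _ c ha
  | mem z hz =>
    obtain ⟨s, hs, p, hp, x, hx, rfl⟩ := hz
    rw [koszulSnd, LinearMap.restrictScalars_apply, koszul, LinearMap.liftBaseChange_tmul,
      LinearMap.comp_apply]
    obtain ⟨y, hy⟩ := comul_mem V i x hx
    rw [← hy]
    clear hy
    induction y with
    | zero => simp
    | add a b ha hb => rw [map_add, map_add, smul_add]; exact add_mem ha hb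
    | tmul w x' =>
      refine Submodule.subset_span ⟨s, hs, p * SymmetricAlgebra.ι ℂ V w,
        by rw [pow_succ]; exact Submodule.mul_mem_mul hp ⟨w, rfl⟩, x', x'.2, ?_⟩
      rw [LinearMap.lTensor_tmul, LinearMap.rTensor_tmul, TensorProduct.smul_tmul', smul_eq_mul,
        LinearMap.comp_apply, TensorProduct.mk_apply, Algebra.TensorProduct.tmul_mul_tmul, mul_one]
      rfl

theorem koszulSnd_mem_triFiltration {a n i : ℕ} {z} (hz : z ∈ triFiltration V n (i + 1) a) :
    koszulSnd V z ∈ triFiltration V (n + 1) i a := by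
  induction a generalizing z with
  | zero => rw [(Submodule.mem_bot ℂ).1 hz, map_zero]; exact zero_mem _
  | succ a ih =>
    obtain ⟨x, hx, y, hy, rfl⟩ := Submodule.mem_sup.1 hz
    rw [map_add]
    exact add_mem (triFiltration_mono V _ _ a.le_succ (ih hx))
      (triDegree_le_triFiltration V _ _ a.lt_succ_self (koszulSnd_mem_triDegree hy))

theorem koszul_tmul_of_mem_zero {T : Type*} [CommRing T] [Algebra ℂ T] (γ : V →ₗ[ℂ] T) (t : T)
    {x : ExteriorAlgebra ℂ V} (hx : x ∈ ⋀[ℂ]^0 V) : koszul γ (t ⊗ₜ x) = 0 := by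
  obtain ⟨c, rfl⟩ : x ∈ (1 : Submodule ℂ (ExteriorAlgebra ℂ V)) := hx
  refine (congrArg (koszul γ) ?_).trans (koszul_tmul_one γ (c • t))
  rw [TensorProduct.smul_tmul]
  simp

variable (V) in
/-- The multiplication `(s ⊗ p) ⊗ x ↦ s p ε(x)`, where `ε` is the augmentation of `⋀V`. -/
noncomputable def multAug : (SymmetricAlgebra ℂ V ⊗[ℂ] SymmetricAlgebra ℂ V) ⊗[ℂ]
    ExteriorAlgebra ℂ V →ₐ[ℂ] SymmetricAlgebra ℂ V :=
  Algebra.TensorProduct.lift (Algebra.TensorProduct.lmul' ℂ)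
    ((Algebra.ofId ℂ _).comp ExteriorAlgebra.algebraMapInv) (fun _ _ => Commute.all _ _)

theorem multAug_tmul (s p : SymmetricAlgebra ℂ V) (x : ExteriorAlgebra ℂ V) :
    multAug V ((s ⊗ₜ p) ⊗ₜ x) = s * p * algebraMap ℂ _ (ExteriorAlgebra.algebraMapInv x) := by
  simp [multAug, Algebra.ofId_apply]

/-- After multiplication it no longer matters which symmetric factor receives the contracted vector.
Hence the augmentation kills e₁ of every e₂-closed element. -/
theorem multAug_koszulSnd (z : (SymmetricAlgebra ℂ V ⊗[ℂ] SymmetricAlgebra ℂ V) ⊗[ℂ]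
    ExteriorAlgebra ℂ V) : multAug V (koszulSnd V z) = multAug V (koszulFst V z) := by
  induction z with
  | zero => simp
  | add a b ha hb => simp only [map_add, ha, hb]
  | tmul t x =>
    simp only [koszulSnd, koszulFst, LinearMap.restrictScalars_apply, koszul,
      LinearMap.liftBaseChange_tmul, LinearMap.comp_apply]
    generalize comul V x = y
    induction y with
    | zero => simp
    | add a b ha hb => simp only [map_add, smul_add, ha, hb]
    | tmul w x' =>
      have h : ∀ t' : SymmetricAlgebra ℂ V ⊗[ℂ] SymmetricAlgebra ℂ V, multAug V (t • t' ⊗ₜ x') =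
          Algebra.TensorProduct.lmul' ℂ t * Algebra.TensorProduct.lmul' ℂ t' *
            algebraMap ℂ _ (ExteriorAlgebra.algebraMapInv x') := fun t' => by
        rw [TensorProduct.smul_tmul', smul_eq_mul, ← map_mul]
        simp [multAug, Algebra.ofId_apply]
      rw [LinearMap.rTensor_tmul, LinearMap.rTensor_tmul, h, h]
      simp [coeffForm]

/-- The product vanishes for i > 0 and is unconstrained for i = 0; the factor i treats both cases at
once. -/
theorem smul_multAug_of_mem {k n i : ℕ} {z} (hz : z ∈ triDegree V k n i) :
    (i : ℂ) • multAug V z = 0 := by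
  induction hz using Submodule.span_induction with
  | zero => simp
  | add a b _ _ ha hb => rw [map_add, smul_add, ha, hb, add_zero]
  | smul c a _ ha => rw [map_smul, smul_comm, ha, smul_zero]
  | mem z hz =>
    obtain ⟨s, hs, p, hp, x, hx, rfl⟩ := hz
    rw [multAug_tmul]
    cases i with
    | zero => simp
    | succ i =>
      suffices h : ExteriorAlgebra.algebraMapInv x = 0 by simp [h]
      change x ∈ LinearMap.range (ExteriorAlgebra.ι ℂ (M := V)) ^ (i + 1) at hx
      rw [pow_succ'] at hx
      induction hx using Submodule.mul_induction_on' with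
      | mem_mul_mem m hm n hn =>
        obtain ⟨v, rfl⟩ := hm
        rw [map_mul]; simp [ExteriorAlgebra.algebraMapInv]
      | add x _ y _ hx hy => rw [map_add, hx, hy, add_zero]

theorem multAug_eq_zero_of_mem {n i : ℕ}
    (y : SymmetricAlgebra ℂ V ⊗[ℂ] ((⋀[ℂ]^(i + 1) V) ⊗[ℂ] (symPow V (n : ℤ)))) :
    multAug V (inclBase V V (SymmetricAlgebra ℂ V) (i + 1) n y) = 0 := by
  obtain ⟨a, ha⟩ := exists_mem_triFiltration y
  generalize inclBase V V (SymmetricAlgebra ℂ V) (i + 1) n y = z at ha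
  induction a generalizing z with
  | zero => rw [(Submodule.mem_bot ℂ).1 ha, map_zero]
  | succ a ih =>
    obtain ⟨x, hx, y, hy, rfl⟩ := Submodule.mem_sup.1 ha
    have h := smul_multAug_of_mem hy
    rw [smul_eq_zero, or_iff_right (Nat.cast_ne_zero.2 i.succ_ne_zero)] at h
    rw [map_add, h, ih _ hx, add_zero]

theorem multAug_mem_of_mem {k n i : ℕ} {z} (hz : z ∈ triDegree V k n i) :
    multAug V z ∈ LinearMap.range (SymmetricAlgebra.ι ℂ V) ^ (k + n) := by
  induction hz using Submodule.span_induction with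
  | zero => simp
  | add a b _ _ ha hb => rw [map_add]; exact add_mem ha hb
  | smul c a _ ha => rw [map_smul]; exact Submodule.smul_mem _ c ha
  | mem z hz =>
    obtain ⟨s, hs, p, hp, x, hx, rfl⟩ := hz
    rw [multAug_tmul, mul_comm, ← Algebra.smul_def, pow_add]
    exact Submodule.smul_mem _ _ (Submodule.mul_mem_mul hs hp)

/-- Exactness in the second symmetric factor. -/
theorem exists_koszulSnd_eq {n i : ℕ} {z}
    (hz : z ∈ LinearMap.range (inclBase V V (SymmetricAlgebra ℂ V) i (n + 1 : ℕ)))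
    (hz0 : koszulSnd V z = 0) :
    ∃ t ∈ LinearMap.range (inclBase V V (SymmetricAlgebra ℂ V) (i + 1) n), koszulSnd V t = z := by
  obtain ⟨z, rfl⟩ := hz
  -- By flatness the kernel of e₂ is S ⊗ hook, and each hook element lifts by Koszul exactness in
  -- symmetric degree n + 1.
  obtain ⟨y, hy⟩ := mem_range_resIncl V (SymmetricAlgebra ℂ V) (n + 1) i z hz0
  rw [← hy]
  clear hy hz0
  induction y using TensorProduct.induction_on with
  | zero => exact ⟨0, zero_mem _, by simp⟩
  | add a b ha hb =>
    obtain ⟨t, ht, ht'⟩ := ha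
    obtain ⟨r, hr, hr'⟩ := hb
    exact ⟨t + r, add_mem ht hr, by rw [map_add, map_add, ht', hr']⟩
  | tmul s k =>
    obtain ⟨_, ⟨t, rfl⟩, ht⟩ := exists_koszulDelta_eq (n := n)
      (LinearMap.mem_range_self (incl V V i (n + 1 : ℕ)) k.1) k.2
    refine ⟨inclBase V V _ _ _ (s ⊗ₜ t), ⟨_, rfl⟩, ?_⟩
    rw [koszulSnd, LinearMap.restrictScalars_apply, koszul_inclBase, LinearMap.lTensor_tmul,
      LinearMap.comp_apply, ht]
    rfl

theorem koszulFst_mem_range {n i : ℕ} {z}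
    (hz : z ∈ LinearMap.range (inclBase V V (SymmetricAlgebra ℂ V) (i + 1) (n : ℤ))) :
    koszulFst V z ∈ LinearMap.range (inclBase V V (SymmetricAlgebra ℂ V) i n) := by
  obtain ⟨y, rfl⟩ := hz
  exact koszul_mem (coeffForm (SymmetricAlgebra.ι ℂ V)) 0
    (fun v => ⟨SymmetricAlgebra.ι ℂ V v ⊗ₜ ⟨1, one_mem_symPow V⟩, rfl⟩) i n n (by simp) y

end resolution

/-! ### The Euler operator N and exactness of C -/

section resolution
variable {V : Type u} [AddCommGroup V] [Module ℂ V]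

/-- A derivation of `Sym V ⊗ Sym V` over the second factor. -/
def IsFstDerivation (D : Derivation ℂ (SymmetricAlgebra ℂ V ⊗[ℂ] SymmetricAlgebra ℂ V)
    ((SymmetricAlgebra ℂ V ⊗[ℂ] SymmetricAlgebra ℂ V) ⊗[ℂ] V)) : Prop :=
  (∀ v, D (SymmetricAlgebra.ι ℂ V v ⊗ₜ 1) = 1 ⊗ₜ v) ∧ ∀ r, D (1 ⊗ₜ r) = 0

/-- The anticommutator of the Koszul and the de Rham differential in the first factor. -/
noncomputable def eulerFst (D : Derivation ℂ (SymmetricAlgebra ℂ V ⊗[ℂ] SymmetricAlgebra ℂ V)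
    ((SymmetricAlgebra ℂ V ⊗[ℂ] SymmetricAlgebra ℂ V) ⊗[ℂ] V)) :
    (SymmetricAlgebra ℂ V ⊗[ℂ] SymmetricAlgebra ℂ V) ⊗[ℂ] ExteriorAlgebra ℂ V →ₗ[ℂ]
    (SymmetricAlgebra ℂ V ⊗[ℂ] SymmetricAlgebra ℂ V) ⊗[ℂ] ExteriorAlgebra ℂ V :=
  koszulFst V ∘ₗ deRham D + deRham D ∘ₗ koszulFst V

variable {D : Derivation ℂ (SymmetricAlgebra ℂ V ⊗[ℂ] SymmetricAlgebra ℂ V)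
    ((SymmetricAlgebra ℂ V ⊗[ℂ] SymmetricAlgebra ℂ V) ⊗[ℂ] V)}

theorem range_coeffForm_pow (k : ℕ) :
    LinearMap.range (coeffForm (SymmetricAlgebra.ι ℂ V)) ^ k =
      (LinearMap.range (SymmetricAlgebra.ι ℂ V) ^ k).map (Algebra.TensorProduct.includeLeft :
        SymmetricAlgebra ℂ V →ₐ[ℂ] SymmetricAlgebra ℂ V ⊗[ℂ] SymmetricAlgebra ℂ V).toLinearMap := by
  rw [Submodule.map_pow, ← LinearMap.range_comp]
  rfl

variable (V) in
/-- The subspace `1 ⊗ Symⁿ V` of `Sym V ⊗ Sym V`. -/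
noncomputable def sndSymPow (n : ℕ) :
    Submodule ℂ (SymmetricAlgebra ℂ V ⊗[ℂ] SymmetricAlgebra ℂ V) :=
  (LinearMap.range (SymmetricAlgebra.ι ℂ V) ^ n).map (TensorProduct.mk ℂ _ _ 1)

theorem tmul_mem_mul_sndSymPow {k n : ℕ} {s p : SymmetricAlgebra ℂ V}
    (hs : s ∈ LinearMap.range (SymmetricAlgebra.ι ℂ V) ^ k)
    (hp : p ∈ LinearMap.range (SymmetricAlgebra.ι ℂ V) ^ n) :
    s ⊗ₜ p ∈ LinearMap.range (coeffForm (SymmetricAlgebra.ι ℂ V)) ^ k * sndSymPow V n := by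
  have h : s ⊗ₜ[ℂ] p = (s ⊗ₜ 1) * (1 ⊗ₜ p) := by simp
  rw [h, range_coeffForm_pow]
  exact Submodule.mul_mem_mul (Submodule.mem_map_of_mem hs) (Submodule.mem_map_of_mem hp)

theorem tmul_mem_triDegree {k n i : ℕ} {t : SymmetricAlgebra ℂ V ⊗[ℂ] SymmetricAlgebra ℂ V}
    (ht : t ∈ LinearMap.range (coeffForm (SymmetricAlgebra.ι ℂ V)) ^ k * sndSymPow V n)
    {x : ExteriorAlgebra ℂ V} (hx : x ∈ ⋀[ℂ]^i V) : t ⊗ₜ x ∈ triDegree V k n i := by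
  rw [range_coeffForm_pow] at ht
  induction ht using Submodule.mul_induction_on' with
  | add a _ b _ ha hb => rw [TensorProduct.add_tmul]; exact add_mem ha hb
  | mem_mul_mem a ha b hb =>
    obtain ⟨s, hs, rfl⟩ := ha
    obtain ⟨p, hp, rfl⟩ := hb
    refine Submodule.subset_span ⟨s, hs, p, hp, x, hx, ?_⟩
    congr 1
    exact (Algebra.TensorProduct.tmul_mul_tmul _ _ _ _).trans (by rw [mul_one, one_mul])

variable (hD : IsFstDerivation D)
include hD

theorem IsFstDerivation.apply_coeffForm (v : V) :
    D (coeffForm (SymmetricAlgebra.ι ℂ V) v) = 1 ⊗ₜ v := hD.1 v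

theorem IsFstDerivation.apply_sndSymPow (n : ℕ) (q) (hq : q ∈ sndSymPow V n) : D q = 0 := by
  obtain ⟨p, _, rfl⟩ := hq
  exact hD.2 p

theorem eulerFst_of_mem_triDegree {k n i : ℕ} {z} (hz : z ∈ triDegree V k n i) :
    eulerFst D z = ((k : ℂ) + i) • z := by
  induction hz using Submodule.span_induction with
  | zero => simp
  | add a b _ _ ha hb => rw [map_add, smul_add, ha, hb]
  | smul c a _ ha => rw [map_smul, smul_comm, ha]
  | mem z hz =>
    obtain ⟨s, hs, p, hp, x, hx, rfl⟩ := hz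
    exact koszul_deRham_add hD.apply_coeffForm k _ (liftBaseChange_derivation hD.apply_coeffForm
      (hD.apply_sndSymPow n) k _ (tmul_mem_mul_sndSymPow hs hp)) i x hx

theorem deRham_mem_triDegree {k n i : ℕ} {z} (hz : z ∈ triDegree V (k + 1) n i) :
    deRham D z ∈ triDegree V k n (i + 1) := by
  induction hz using Submodule.span_induction with
  | zero => simp
  | add a b _ _ ha hb => rw [map_add]; exact add_mem ha hb
  | smul c a _ ha => rw [map_smul]; exact Submodule.smul_mem _ c ha
  | mem z hz =>
    obtain ⟨s, hs, p, hp, x, hx, rfl⟩ := hz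
    rw [deRham_tmul]
    have h := derivation_mem_span hD.apply_coeffForm (hD.apply_sndSymPow n) (k + 1) _
      (tmul_mem_mul_sndSymPow hs hp)
    generalize D (s ⊗ₜ p) = y at h
    induction h using Submodule.span_induction with
    | zero => simp
    | add a b _ _ ha hb => rw [map_add, add_mul]; exact add_mem ha hb
    | smul c a _ ha =>
      rw [LinearMap.map_smul_of_tower, smul_mul_assoc]; exact Submodule.smul_mem _ c ha
    | mem y hy =>
      obtain ⟨j, hj, t, ht, w, rfl⟩ := hy
      obtain rfl : j = k := by omega
      rw [oneForm_tmul, Algebra.TensorProduct.tmul_mul_tmul, mul_one]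
      exact tmul_mem_triDegree ht (ι_mul_mem w hx)

theorem deRham_eq_zero_of_mem_triDegree {n i : ℕ} {z} (hz : z ∈ triDegree V 0 n i) :
    deRham D z = 0 := by
  induction hz using Submodule.span_induction with
  | zero => simp
  | add a b _ _ ha hb => rw [map_add, ha, hb, add_zero]
  | smul c a _ ha => rw [map_smul, ha, smul_zero]
  | mem z hz =>
    obtain ⟨s, hs, p, hp, x, hx, rfl⟩ := hz
    rw [deRham_tmul]
    have h := derivation_mem_span hD.apply_coeffForm (hD.apply_sndSymPow n) 0 _
      (tmul_mem_mul_sndSymPow hs hp)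
    have h0 : D (s ⊗ₜ p) = 0 := by
      refine (Submodule.mem_bot ℂ).1 (Submodule.span_le.2 ?_ h)
      rintro _ ⟨j, hj, _⟩
      exact absurd hj j.succ_ne_zero
    rw [h0, map_zero, zero_mul]

theorem deRham_mem_triFiltration {a n i : ℕ} {z} (hz : z ∈ triFiltration V n i (a + 1)) :
    deRham D z ∈ triFiltration V n (i + 1) a := by
  induction a generalizing z with
  | zero =>
    obtain ⟨x, hx, y, hy, rfl⟩ := Submodule.mem_sup.1 hz
    rw [(Submodule.mem_bot ℂ).1 hx, zero_add, deRham_eq_zero_of_mem_triDegree hD hy]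
    exact zero_mem _
  | succ a ih =>
    obtain ⟨x, hx, y, hy, rfl⟩ := Submodule.mem_sup.1 hz
    rw [map_add]
    exact add_mem (triFiltration_mono V _ _ a.le_succ (ih hx))
      (triDegree_le_triFiltration V _ _ a.lt_succ_self (deRham_mem_triDegree hD hy))

theorem eulerFst_mem_triFiltration {a n i : ℕ} {z} (hz : z ∈ triFiltration V n i a) :
    eulerFst D z ∈ triFiltration V n i a := by
  induction a generalizing z with
  | zero => rw [(Submodule.mem_bot ℂ).1 hz, map_zero]; exact zero_mem _
  | succ a ih =>
    obtain ⟨x, hx, y, hy, rfl⟩ := Submodule.mem_sup.1 hz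
    rw [map_add, eulerFst_of_mem_triDegree hD hy]
    exact add_mem (triFiltration_mono V _ _ a.le_succ (ih hx))
      (triDegree_le_triFiltration V _ _ a.lt_succ_self (Submodule.smul_mem _ _ hy))

/-- N acts as a + i on the top stratum of stage a + 1 and preserves the filtration, so (a + i) - N
drops one stage. -/
theorem exists_smul_eq_add_eulerFst {a n i : ℕ} {z} (hz : z ∈ triFiltration V n i (a + 1)) :
    ∃ y ∈ triFiltration V n i a, ((a : ℂ) + i) • z = y + eulerFst D z := by
  obtain ⟨x, hx, y, hy, rfl⟩ := Submodule.mem_sup.1 hz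
  refine ⟨((a : ℂ) + i) • x + (-1 : ℂ) • eulerFst D x, add_mem (Submodule.smul_mem _ _ hx)
    (Submodule.smul_mem _ _ (eulerFst_mem_triFiltration hD hx)), ?_⟩
  rw [map_add, smul_add, eulerFst_of_mem_triDegree hD hy]
  module

/-- e₂ keeps the first symmetric degree and lowers the exterior degree by one, so the eigenvalue of
N drops by one. For i = 0 both sides vanish. -/
theorem koszulSnd_eulerFst {a n i : ℕ} {z} (hz : z ∈ triFiltration V n i a) :
    koszulSnd V (eulerFst D z) = eulerFst D (koszulSnd V z) + koszulSnd V z := by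
  induction a generalizing z with
  | zero => rw [(Submodule.mem_bot ℂ).1 hz]; simp
  | succ a ih =>
    obtain ⟨x, hx, y, hy, rfl⟩ := Submodule.mem_sup.1 hz
    rw [map_add, map_add, map_add, map_add, ih hx, eulerFst_of_mem_triDegree hD hy, map_smul]
    have h : ((a : ℂ) + i) • koszulSnd V y = eulerFst D (koszulSnd V y) + koszulSnd V y := by
      cases i with
      | zero =>
        have h0 : koszulSnd V y = 0 := by
          clear hz ih
          induction hy using Submodule.span_induction with
          | zero => simp
          | add a b _ _ ha hb => rw [map_add, ha, hb, add_zero]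
          | smul c a _ ha => rw [map_smul, ha, smul_zero]
          | mem z hz =>
            obtain ⟨s, hs, p, hp, x, hx, rfl⟩ := hz
            exact koszul_tmul_of_mem_zero _ _ hx
        rw [h0]; simp
      | succ i =>
        rw [eulerFst_of_mem_triDegree hD (koszulSnd_mem_triDegree hy)]
        push_cast
        rw [← add_assoc, add_smul _ (1 : ℂ), one_smul]
    rw [h]
    abel

/-- Let E be the Euler operator of Sym V. In tridegree (k, n, i) the product has degree k + n, so
multiplication turns N into E - n; the extra term i contributes nothing, by `smul_multAug_of_mem`.
Hence N preserves the kernel of multiplication. -/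
theorem multAug_eulerFst {a n i : ℕ} {z} (hz : z ∈ triFiltration V n i a)
    (hz0 : multAug V z = 0) : multAug V (eulerFst D z) = 0 := by
  obtain ⟨D', hD'⟩ := exists_derivation_symmetricAlgebra V
  have h : multAug V (eulerFst D z) = LinearMap.liftBaseChange _ (SymmetricAlgebra.ι ℂ V)
      (D' (multAug V z)) - (n : ℂ) • multAug V z := by
    clear hz0
    induction a generalizing z with
    | zero => rw [(Submodule.mem_bot ℂ).1 hz]; simp
    | succ a ih =>
      obtain ⟨x, hx, y, hy, rfl⟩ := Submodule.mem_sup.1 hz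
      have h1 := liftBaseChange_derivation hD' (derivation_apply_of_mem_one D') (a + n)
        (multAug V y) (by rw [mul_one]; exact multAug_mem_of_mem hy)
      simp only [map_add, ih hx, eulerFst_of_mem_triDegree hD hy, smul_add, map_smul, h1]
      rw [add_smul, smul_multAug_of_mem hy]
      push_cast
      rw [add_smul]
      abel
  rw [h, hz0]
  simp

omit hD in
-- Such an element has the form (1 ⊗ p) ⊗ 1, and p is its product.
theorem eq_zero_of_mem_triDegree_zero {n : ℕ} {z} (hz : z ∈ triDegree V 0 n 0)
    (hz0 : multAug V z = 0) : z = 0 := by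
  have h : z = ((1 : SymmetricAlgebra ℂ V) ⊗ₜ[ℂ] multAug V z) ⊗ₜ[ℂ] (1 : ExteriorAlgebra ℂ V) := by
    clear hz0
    induction hz using Submodule.span_induction with
    | zero => simp
    | add a b _ _ ha hb =>
      rw [map_add, TensorProduct.tmul_add, TensorProduct.add_tmul, ← ha, ← hb]
    | smul c a _ ha =>
      rw [map_smul, TensorProduct.tmul_smul, ← TensorProduct.smul_tmul', ← ha]
    | mem z hz =>
      obtain ⟨s, hs, p, hp, x, hx, rfl⟩ := hz
      rw [pow_zero] at hs
      obtain ⟨c, rfl⟩ := Submodule.mem_one.1 hs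
      have hx' : x ∈ (1 : Submodule ℂ (ExteriorAlgebra ℂ V)) := hx
      obtain ⟨d, rfl⟩ := Submodule.mem_one.1 hx'
      rw [multAug_tmul, AlgHom.commutes]
      simp only [Algebra.algebraMap_eq_smul_one, smul_eq_mul,
        ← TensorProduct.smul_tmul', TensorProduct.tmul_smul, smul_mul_assoc, mul_smul_comm,
        one_mul, mul_one, smul_smul]
  rw [h, hz0]
  simp

/-- Exactness in the first symmetric factor, on the kernel of the second differential. -/
theorem exists_koszulFst_eq (a n i : ℕ) {z} (hz : z ∈ triFiltration V n i a)
    (h1 : koszulFst V z = 0) (h2 : koszulSnd V z = 0) (h3 : multAug V z = 0) :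
    ∃ u ∈ LinearMap.range (inclBase V V (SymmetricAlgebra ℂ V) (i + 1) n),
      koszulSnd V u = 0 ∧ koszulFst V u = z := by
  induction a generalizing n i z with
  | zero => exact ⟨0, zero_mem _, by simp, by rw [map_zero, (Submodule.mem_bot ℂ).1 hz]⟩
  | succ a ih =>
    -- The scalar a + i must be inverted. It vanishes only in tridegree (0, n, 0), where the
    -- augmentation condition forces z = 0.
    by_cases hai : a + i = 0
    · obtain ⟨rfl, rfl⟩ : a = 0 ∧ i = 0 := by omega
      obtain ⟨x, hx, y, hy, rfl⟩ := Submodule.mem_sup.1 hz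
      rw [(Submodule.mem_bot ℂ).1 hx, zero_add] at h3 ⊢
      rw [eq_zero_of_mem_triDegree_zero hy h3]
      exact ⟨0, zero_mem _, by simp, by simp⟩
    have hc : (a : ℂ) + i ≠ 0 := by exact_mod_cast hai
    have hN : eulerFst D z = koszulFst V (deRham D z) := by
      rw [eulerFst, LinearMap.add_apply, LinearMap.comp_apply, LinearMap.comp_apply, h1, map_zero,
        add_zero]
    have hN1 : koszulFst V (eulerFst D z) = 0 := by rw [hN, koszulFst_koszulFst]
    have hN2 : koszulSnd V (eulerFst D z) = 0 := by
      rw [koszulSnd_eulerFst hD hz, h2, map_zero, add_zero]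
    have hN3 := multAug_eulerFst hD hz h3
    -- Here (a + i) z = y + N z. The summand y lies one stage lower and inherits the three
    -- conditions from z and N z, so induction lifts it; N z = e₁ (d z) remains.
    obtain ⟨y, hy, hyz⟩ := exists_smul_eq_add_eulerFst hD hz
    obtain ⟨u, hu, hu2, hu1⟩ := ih n i hy
      (by
        have h := congrArg (koszulFst V) hyz
        rw [map_smul, map_add, h1, hN1, smul_zero, add_zero] at h
        exact h.symm)
      (by
        have h := congrArg (koszulSnd V) hyz
        rw [map_smul, map_add, h2, hN2, smul_zero, add_zero] at h
        exact h.symm)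
      (by
        have h := congrArg (multAug V) hyz
        rw [map_smul, map_add, h3, hN3, smul_zero, add_zero] at h
        exact h.symm)
    -- The defect e₂ d z satisfies the three conditions one stage lower, with n + 1 in place of n.
    -- This is why the induction generalizes n.
    have hw := deRham_mem_triFiltration hD hz
    obtain ⟨r, hr, hr2, hr1⟩ := ih (n + 1) i (koszulSnd_mem_triFiltration hw)
      (by
        have h := koszulFst_koszulSnd (deRham D z)
        rwa [← hN, hN2, add_zero] at h)
      (koszulSnd_koszulSnd _) (by rw [multAug_koszulSnd, ← hN, hN3])
    -- Since r = e₂ t, anticommutation makes d z + e₁ t closed under e₂, and e₁ e₁ = 0 leaves its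
    -- e₁-image equal to N z.
    obtain ⟨t, ht, rfl⟩ := exists_koszulSnd_eq hr hr2
    refine ⟨((a : ℂ) + i)⁻¹ • (u + (deRham D z + koszulFst V t)), ?_, ?_, ?_⟩
    · rw [← algebraMap_smul (SymmetricAlgebra ℂ V)]
      exact Submodule.smul_mem _ _ (add_mem hu (add_mem (triFiltration_le_range _ _ _ hw)
        (koszulFst_mem_range ht)))
    · rw [map_smul, map_add, map_add, hu2, ← hr1, koszulFst_koszulSnd, add_zero, smul_zero]
    · rw [map_smul, map_add, map_add, hu1, koszulFst_koszulFst, add_zero, ← hN, ← hyz,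
        smul_smul, inv_mul_cancel₀ hc, one_smul]

omit hD

theorem exists_resIncl_eq {n i : ℕ}
    (y : SymmetricAlgebra ℂ V ⊗[ℂ] ((⋀[ℂ]^i V) ⊗[ℂ] (symPow V (n : ℤ))))
    (h1 : koszulFst V (inclBase V V _ i n y) = 0) (h2 : koszulSnd V (inclBase V V _ i n y) = 0)
    (h3 : multAug V (inclBase V V _ i n y) = 0) :
    ∃ u : ResTerm V (SymmetricAlgebra ℂ V) n (i + 1),
      koszulFst V (resIncl V _ n (i + 1) u) = inclBase V V _ i n y := by
  obtain ⟨D, hD⟩ := exists_derivation_symmetricAlgebra_tensor V (SymmetricAlgebra ℂ V)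
  obtain ⟨a, ha⟩ := exists_mem_triFiltration y
  obtain ⟨_, ⟨u, rfl⟩, hu2, hu1⟩ := exists_koszulFst_eq (D := D) hD a n i ha h1 h2 h3
  obtain ⟨r, hr⟩ := mem_range_resIncl V (SymmetricAlgebra ℂ V) n (i + 1) u hu2
  exact ⟨r, by rw [hr, hu1]⟩

theorem resD_exact (n i : ℕ) : Function.Exact (resD (SymmetricAlgebra.ι ℂ V) n (i + 1))
    (resD (SymmetricAlgebra.ι ℂ V) n i) := by
  intro y
  constructor
  · intro hy
    obtain ⟨u, hu⟩ := exists_resIncl_eq ((hook V n (i + 1)).subtype.baseChange _ y)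
      (by
        have h := resIncl_resD (SymmetricAlgebra.ι ℂ V) n i y
        rw [hy, map_zero] at h
        exact h.symm)
      (koszul_resIncl V _ n (i + 1) y) (multAug_eq_zero_of_mem _)
    exact ⟨u, resIncl_injective V _ n (i + 1) ((resIncl_resD _ n (i + 1) u).trans hu)⟩
  · rintro ⟨u, rfl⟩
    exact LinearMap.congr_fun (resD_resD (SymmetricAlgebra.ι ℂ V) n i) u

theorem multAug_resIncl (n : ℕ) (y : ResTerm V (SymmetricAlgebra ℂ V) n 0) :
    multAug V (resIncl V _ n 0 y) = resAug V n y := by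
  have h : (multAug V).toLinearMap ∘ₗ (resIncl V _ n 0).restrictScalars ℂ =
      (resAug V n).restrictScalars ℂ := by
    apply TensorProduct.ext'
    rintro s ⟨k, hk⟩
    change multAug V (inclBase V V _ 0 n (s ⊗ₜ k)) = _
    rw [LinearMap.restrictScalars_apply, resAug, LinearMap.liftBaseChange_tmul, augCoeff]
    simp only [LinearMap.comp_apply, Submodule.subtype_apply]
    clear hk
    induction k using TensorProduct.induction_on with
    | zero => simp
    | add a b ha hb =>
      simp only [map_add, TensorProduct.tmul_add, Submodule.coe_add, smul_add, ha, hb]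
    | tmul x p =>
      obtain ⟨c, rfl⟩ := (exteriorPower.zeroEquiv ℂ V).symm.surjective x
      rw [inclBase_tmul, multAug_tmul, LinearEquiv.coe_coe, LinearMap.rTensor_tmul,
        LinearEquiv.coe_coe, LinearEquiv.apply_symm_apply, TensorProduct.lid_tmul]
      simp only [exteriorPower.zeroEquiv_symm_apply, Submodule.coe_smul,
        exteriorPower.ιMulti_apply_coe, ExteriorAlgebra.ιMulti_zero_apply, map_smul, map_one,
        smul_eq_mul, mul_one]
      rw [mul_assoc, mul_comm _ (algebraMap _ _ _), ← Algebra.smul_def]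
  exact LinearMap.congr_fun h y

theorem resAug_exact (n : ℕ) : Function.Exact (resD (SymmetricAlgebra.ι ℂ V) n 0)
    (resAug V n) := by
  have hzero : ∀ y : ResTerm V (SymmetricAlgebra ℂ V) n 0, koszulFst V (resIncl V _ n 0 y) = 0 := by
    intro y
    change koszulFst V (inclBase V V _ 0 n ((hook V n 0).subtype.baseChange _ y)) = 0
    generalize (hook V n 0).subtype.baseChange _ y = z
    induction z using TensorProduct.induction_on with
    | zero => simp
    | add a b ha hb => rw [map_add, map_add, ha, hb, add_zero]
    | tmul s t =>
      induction t using TensorProduct.induction_on with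
      | zero => simp
      | add a b ha hb => rw [TensorProduct.tmul_add, map_add, map_add, ha, hb, add_zero]
      | tmul x p => exact koszul_tmul_of_mem_zero _ _ x.2
  intro y
  constructor
  · intro hy
    obtain ⟨u, hu⟩ := exists_resIncl_eq ((hook V n 0).subtype.baseChange _ y) (hzero y)
      (koszul_resIncl V _ n 0 y) ((multAug_resIncl n y).trans hy)
    exact ⟨u, resIncl_injective V _ n 0 ((resIncl_resD _ n 0 u).trans hu)⟩
  · rintro ⟨u, rfl⟩
    rw [← multAug_resIncl, resIncl_resD]
    change multAug V (koszulFst V (resIncl V _ n 1 u)) = 0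
    rw [← multAug_koszulSnd]
    exact (congrArg _ (koszul_resIncl V _ n 1 u)).trans (map_zero _)

end resolution

/-! ### Minimality, image of the augmentation, finite rank -/

section resolution
variable {V : Type u} [AddCommGroup V] [Module ℂ V]

theorem resComplex_d (n i : ℕ) : (resComplex V n).d (i + 1) i =
    ModuleCat.ofHom (resD (SymmetricAlgebra.ι ℂ V) n i) :=
  ChainComplex.of_d (fun i => ModuleCat.of _ (ResTerm V (SymmetricAlgebra ℂ V) n i))
    (fun i => ModuleCat.ofHom (resD (SymmetricAlgebra.ι ℂ V) n i)) i

/-- The Koszul differential of a linear form with values in an ideal `I` maps to `I` times the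
Koszul algebra. -/
theorem koszul_mem_smul_top {S T W : Type*} [CommRing S] [CommRing T] [Algebra ℂ T] [Algebra ℂ S]
    [Algebra S T] [IsScalarTower ℂ S T] [AddCommGroup W] [Module ℂ W]
    (g : W →ₗ[ℂ] S) (I : Ideal S) (hg : ∀ w, g w ∈ I) (y : T ⊗[ℂ] ExteriorAlgebra ℂ W) :
    koszul ((Algebra.linearMap S T).restrictScalars ℂ ∘ₗ g) y ∈
      I • (⊤ : Submodule S (T ⊗[ℂ] ExteriorAlgebra ℂ W)) := by
  induction y with
  | zero => simp
  | add a b ha hb => rw [map_add]; exact add_mem ha hb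
  | tmul t x =>
    rw [koszul, LinearMap.liftBaseChange_tmul, LinearMap.comp_apply]
    generalize comul W x = y
    induction y with
    | zero => simp
    | add a b ha hb => rw [map_add, smul_add]; exact add_mem ha hb
    | tmul w x' =>
      have h : t • ((Algebra.linearMap S T).restrictScalars ℂ ∘ₗ g).rTensor
          (ExteriorAlgebra ℂ W) (w ⊗ₜ x') = g w • (t ⊗ₜ[ℂ] x') := by
        rw [LinearMap.rTensor_tmul, TensorProduct.smul_tmul', TensorProduct.smul_tmul']
        congr 1
        rw [smul_eq_mul, mul_comm, Algebra.smul_def]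
        rfl
      rw [h]
      exact Submodule.smul_mem_smul (hg w) trivial

theorem exists_leftInverse_resIncl (n i : ℕ) :
    ∃ π : (SymmetricAlgebra ℂ V ⊗[ℂ] SymmetricAlgebra ℂ V) ⊗[ℂ] ExteriorAlgebra ℂ V
      →ₗ[SymmetricAlgebra ℂ V] ResTerm V (SymmetricAlgebra ℂ V) n i,
      ∀ y, π (resIncl V _ n i y) = y := by
  have hinj : Function.Injective (incl V V i n ∘ₗ (hook V n i).subtype) :=
    (incl_injective V V i n).comp (hook V n i).injective_subtype
  -- The splitting of an injection of vector spaces needs an additive group; this one extends the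
  -- given monoid structure.
  let _ := Module.addCommMonoidToAddCommGroup ℂ (M := hook V n i)
  obtain ⟨ρ, hρ⟩ := LinearMap.exists_leftInverse_of_injective _ (LinearMap.ker_eq_bot.2 hinj)
  refine ⟨ρ.baseChange _ ∘ₗ (TensorProduct.AlgebraTensorModule.assoc ℂ ℂ (SymmetricAlgebra ℂ V)
    (SymmetricAlgebra ℂ V) (SymmetricAlgebra ℂ V) (ExteriorAlgebra ℂ V)).toLinearMap,
    fun y => ?_⟩
  rw [resIncl, inclBase, LinearMap.comp_apply, LinearMap.comp_apply, LinearMap.comp_apply,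
    LinearEquiv.coe_coe, LinearEquiv.coe_coe, LinearEquiv.apply_symm_apply]
  induction y using TensorProduct.induction_on with
  | zero => simp
  | add a b ha hb => simp only [map_add, ha, hb]
  | tmul s k =>
    simp only [LinearMap.baseChange_tmul]
    rw [show ρ (incl V V i n ((hook V n i).subtype k)) = k from LinearMap.congr_fun hρ k]

/-- In the ambient module the differential visibly lands in the irrelevant ideal times everything.
An S-linear retraction onto S ⊗ hook, base-changed from a splitting over ℂ, carries this back to the
submodule. -/
theorem range_resD_le (n i : ℕ) : LinearMap.range (resD (SymmetricAlgebra.ι ℂ V) n i) ≤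
    irrelevant V • (⊤ : Submodule (SymmetricAlgebra ℂ V)
      (ResTerm V (SymmetricAlgebra ℂ V) n i)) := by
  rintro _ ⟨y, rfl⟩
  obtain ⟨π, hπ⟩ := exists_leftInverse_resIncl (V := V) n i
  rw [← hπ (resD _ n i y), resIncl_resD]
  have h := koszul_mem_smul_top (T := SymmetricAlgebra ℂ V ⊗[ℂ] SymmetricAlgebra ℂ V)
    (SymmetricAlgebra.ι ℂ V) (irrelevant V) (fun v => Ideal.subset_span ⟨v, rfl⟩)
    (resIncl V _ n (i + 1) y)
  have h' := Submodule.mem_map_of_mem (f := π) h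
  rw [Submodule.map_smul''] at h'
  exact Submodule.smul_mono le_rfl le_top h'

theorem range_resAug (n : ℕ) : LinearMap.range (resAug V n) = irrelevant V ^ n := by
  have h1 : ∀ p : hook V n 0, augCoeff V n p ∈ LinearMap.range (SymmetricAlgebra.ι ℂ V) ^ n := by
    intro p
    rw [← symPow_natCast]
    exact Subtype.property _
  have h2 : ∀ p ∈ LinearMap.range (SymmetricAlgebra.ι ℂ V) ^ n, ∃ k : hook V n 0,
      augCoeff V n k = p := by
    intro p hp
    rw [← symPow_natCast] at hp
    refine ⟨⟨(exteriorPower.zeroEquiv ℂ V).symm 1 ⊗ₜ ⟨p, hp⟩, ?_⟩, ?_⟩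
    · exact koszul_tmul_of_mem_zero _ _ (Subtype.property _)
    · simp [augCoeff]
  apply le_antisymm
  · rintro _ ⟨y, rfl⟩
    induction y using TensorProduct.induction_on with
    | zero => simp
    | add a b ha hb => rw [map_add]; exact add_mem ha hb
    | tmul s p =>
      rw [resAug, LinearMap.liftBaseChange_tmul]
      refine Ideal.mul_mem_left _ s ?_
      have h := h1 p
      generalize augCoeff V n p = q at h
      clear h1 h2 p
      induction h using Submodule.pow_induction_on_left' with
      | algebraMap r => simp
      | add x y i hx hy h1 h2 => exact add_mem h1 h2
      | mem_mul m hm i x hx h =>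
        rw [pow_succ']
        exact Ideal.mul_mem_mul (Ideal.subset_span hm) h
  · rw [irrelevant, Ideal.span, Submodule.span_pow, Submodule.span_le]
    intro x hx
    obtain ⟨k, rfl⟩ := h2 x (Submodule.pow_subset_pow _ (Set.pow_subset_pow_left (n := n)
      (t := (LinearMap.range (SymmetricAlgebra.ι ℂ V) : Set (SymmetricAlgebra ℂ V)))
      (fun _ h => h) hx))
    exact ⟨1 ⊗ₜ k, by rw [resAug, LinearMap.liftBaseChange_tmul, one_smul]⟩

instance finite_symPow [FiniteDimensional ℂ V] (n : ℕ) : Module.Finite ℂ (symPow V (n : ℤ)) := by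
  rw [symPow_natCast]
  exact Module.Finite.iff_fg.2 (Submodule.FG.pow (Submodule.FG.of_finite) n)

theorem isMinimalFreeResolution_resComplex [FiniteDimensional ℂ V] (n : ℕ) :
    IsMinimalFreeResolution (irrelevant V) (irrelevant V ^ n) (resComplex V n) (resAug V n) where
  free i := by
    let _ := Module.addCommMonoidToAddCommGroup ℂ (M := hook V n i)
    have : Module.Free ℂ (hook V n i) := Module.Free.of_divisionRing ℂ _
    exact inferInstanceAs (Module.Free _ (ResTerm V (SymmetricAlgebra ℂ V) n i))
  finite i := by
    have : Module.Finite ℂ ((⋀[ℂ]^i V) ⊗[ℂ] (symPow V (n : ℤ))) := inferInstance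
    let _ := Module.addCommMonoidToAddCommGroup ℂ (M := (⋀[ℂ]^i V) ⊗[ℂ] (symPow V (n : ℤ)))
    have : IsNoetherian ℂ ((⋀[ℂ]^i V) ⊗[ℂ] (symPow V (n : ℤ))) :=
      isNoetherian_of_isNoetherianRing_of_finite ℂ _
    have : Module.Finite ℂ (hook V n i) := inferInstance
    exact inferInstanceAs (Module.Finite _ (ResTerm V (SymmetricAlgebra ℂ V) n i))
  exact_succ i := by
    rw [resComplex_d, resComplex_d]; exact resD_exact n i
  exact_zero := by
    rw [resComplex_d]; exact resAug_exact n
  range_aug := range_resAug n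
  minimal i := by
    rw [resComplex_d]; exact range_resD_le n i

end resolution

/-! ### GL(V)-equivariance -/

section equivariance
variable {V : Type u} [AddCommGroup V] [Module ℂ V] (g : V ≃ₗ[ℂ] V)

theorem coe_exteriorPower_map {W W' : Type*} [AddCommGroup W] [Module ℂ W] [AddCommGroup W']
    [Module ℂ W'] (f : W →ₗ[ℂ] W') (i : ℕ) (x : ⋀[ℂ]^i W) :
    (exteriorPower.map i f x : ExteriorAlgebra ℂ W') = ExteriorAlgebra.map f x := by
  have : (⋀[ℂ]^i W').subtype ∘ₗ exteriorPower.map i f =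
      (ExteriorAlgebra.map f).toLinearMap ∘ₗ (⋀[ℂ]^i W).subtype := by
    apply exteriorPower.linearMap_ext
    ext v
    simp [ExteriorAlgebra.map_apply_ιMulti]
  exact LinearMap.congr_fun this x

theorem symMap_ι (v : V) : symMap g (SymmetricAlgebra.ι ℂ V v) = SymmetricAlgebra.ι ℂ V (g v) := by
  simp [symMap]

theorem resAug_resAct (n : ℕ) (x : ResTerm V (SymmetricAlgebra ℂ V) n 0) :
    resAug V n (resAct g n 0 x) = symMap g (resAug V n x) := by
  have haug : ∀ k : hook V n 0, augCoeff V n (hookMap g n 0 k) = symMap g (augCoeff V n k) := by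
    rintro ⟨k, hk⟩
    change (symPow V (n : ℤ)).subtype (TensorProduct.lid ℂ _
      ((exteriorPower.zeroEquiv ℂ V).toLinearMap.rTensor _ (TensorProduct.map
        (exteriorPower.map 0 g.toLinearMap) (symPowMap g n) k))) = symMap g
        ((symPow V (n : ℤ)).subtype (TensorProduct.lid ℂ _
          ((exteriorPower.zeroEquiv ℂ V).toLinearMap.rTensor _ k)))
    clear hk
    induction k using TensorProduct.induction_on with
    | zero => simp
    | add a b ha hb => simp only [map_add, ha, hb]
    | tmul x p =>
      rw [TensorProduct.map_tmul, LinearMap.rTensor_tmul, LinearMap.rTensor_tmul,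
        TensorProduct.lid_tmul, TensorProduct.lid_tmul, map_smul, map_smul, map_smul]
      have h := LinearMap.congr_fun
        (exteriorPower.zeroEquiv_naturality (R := ℂ) (M := V) g.toLinearMap) x
      rw [LinearMap.comp_apply] at h
      rw [h]
      rfl
  induction x using TensorProduct.induction_on with
  | zero => simp
  | add a b ha hb => simp only [map_add, ha, hb]
  | tmul s k =>
    rw [resAct, TensorProduct.map_tmul, resAug, LinearMap.liftBaseChange_tmul,
      LinearMap.liftBaseChange_tmul, haug, smul_eq_mul, smul_eq_mul, map_mul]
    rfl

theorem koszul_map {T : Type*} [CommRing T] [Algebra ℂ T] (γ : V →ₗ[ℂ] T) (f : T →ₐ[ℂ] T)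
    (hf : ∀ v, f (γ v) = γ (g v)) (y : T ⊗[ℂ] ExteriorAlgebra ℂ V) :
    koszul γ (TensorProduct.map f.toLinearMap (ExteriorAlgebra.map g.toLinearMap).toLinearMap y) =
      TensorProduct.map f.toLinearMap (ExteriorAlgebra.map g.toLinearMap).toLinearMap
        (koszul γ y) := by
  induction y with
  | zero => simp
  | add a b ha hb => simp only [map_add, ha, hb]
  | tmul t x =>
    simp only [TensorProduct.map_tmul, koszul, LinearMap.liftBaseChange_tmul,
      LinearMap.comp_apply, AlgHom.toLinearMap_apply, comul_map]
    generalize comul V x = z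
    induction z with
    | zero => simp
    | add a b ha hb => simp only [map_add, smul_add, ha, hb]
    | tmul w x' => simp [TensorProduct.smul_tmul', hf]

/-- The semilinear action is the restriction of an action on the ambient algebra, where `koszul_map`
gives compatibility with contraction; injectivity of `resIncl` then transfers it. -/
theorem resIncl_resAct (n i : ℕ) (x : ResTerm V (SymmetricAlgebra ℂ V) n i) :
    resIncl V _ n i (resAct g n i x) =
      TensorProduct.map (Algebra.TensorProduct.map (symMap g) (symMap g)).toLinearMap
        (ExteriorAlgebra.map g.toLinearMap).toLinearMap (resIncl V _ n i x) := by
  induction x using TensorProduct.induction_on with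
  | zero => simp
  | add a b ha hb => simp only [map_add, ha, hb]
  | tmul s k =>
    obtain ⟨k, hk⟩ := k
    change inclBase V V _ i n (symMap g s ⊗ₜ TensorProduct.map
      (exteriorPower.map i g.toLinearMap) (symPowMap g n) k) = TensorProduct.map _ _
        (inclBase V V _ i n (s ⊗ₜ k))
    clear hk
    induction k using TensorProduct.induction_on with
    | zero => simp
    | add a b ha hb => simp only [map_add, TensorProduct.tmul_add, ha, hb]
    | tmul x p =>
      rw [TensorProduct.map_tmul, inclBase_tmul, inclBase_tmul, coe_exteriorPower_map]
      rfl

theorem resD_resAct (n i : ℕ) (x : ResTerm V (SymmetricAlgebra ℂ V) n (i + 1)) :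
    resD (SymmetricAlgebra.ι ℂ V) n i (resAct g n (i + 1) x) =
      resAct g n i (resD (SymmetricAlgebra.ι ℂ V) n i x) := by
  apply resIncl_injective V _ n i
  rw [resIncl_resD, resIncl_resAct, resIncl_resAct, resIncl_resD]
  exact koszul_map g _ _ (fun v => by simp [coeffForm, symMap_ι]) _

/-- Both sides are algebra maps in x, so it suffices to compare them on bivectors u ∧ v. -/
theorem koszulMul_map (x : ExteriorAlgebra ℂ (⋀[ℂ]^2 V)) :
    koszulMul V (ExteriorAlgebra.map (wedgeIncl V)
      (ExteriorAlgebra.map (exteriorPower.map 2 g.toLinearMap) x)) =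
    Algebra.TensorProduct.map (symMap g) (ExteriorAlgebra.map g.toLinearMap)
      (koszulMul V (ExteriorAlgebra.map (wedgeIncl V) x)) := by
  have h : ((koszulMul V).comp (ExteriorAlgebra.map (wedgeIncl V))).comp
      (ExteriorAlgebra.map (exteriorPower.map 2 g.toLinearMap)) =
      (Algebra.TensorProduct.map (symMap g) (ExteriorAlgebra.map g.toLinearMap)).comp
        ((koszulMul V).comp (ExteriorAlgebra.map (wedgeIncl V))) := by
    apply ExteriorAlgebra.hom_ext
    apply exteriorPower.linearMap_ext
    ext v
    simp [koszulMul, wedgeIncl_apply, tensorToKoszul_tmul, symMap_ι]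
  exact DFunLike.congr_fun h x

theorem psiFull_map (n i : ℕ) :
    psiFull V n i ∘ₗ TensorProduct.map
        (exteriorPower.map i (exteriorPower.map 2 g.toLinearMap)) (symPowMap g _) =
      hookMap g n i ∘ₗ psiFull V n i := by
  apply TensorProduct.ext'
  intro x p
  apply Subtype.ext
  apply incl_injective V V i n
  have hmap : ∀ z : (⋀[ℂ]^i V) ⊗[ℂ] (symPow V (n : ℤ)), incl V V i n
      (TensorProduct.map (exteriorPower.map i g.toLinearMap) (symPowMap g n) z) =
      Algebra.TensorProduct.map (symMap g) (ExteriorAlgebra.map g.toLinearMap)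
        (incl V V i n z) := by
    intro z
    induction z using TensorProduct.induction_on with
    | zero => simp
    | add a b ha hb => simp only [map_add, ha, hb]
    | tmul x p =>
      rw [TensorProduct.map_tmul, incl_tmul, incl_tmul, coe_exteriorPower_map]
      rfl
  rw [LinearMap.comp_apply, LinearMap.comp_apply, incl_psiFull, TensorProduct.map_tmul]
  refine Eq.trans ?_ (hmap _).symm
  rw [Submodule.subtype_apply, incl_psiFull, TensorProduct.map_tmul, TensorProduct.map_tmul,
    Submodule.subtype_apply, Submodule.subtype_apply, Submodule.subtype_apply, Submodule.subtype_apply, psiAmbient_tmul,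
    psiAmbient_tmul, coe_exteriorPower_map, koszulMul_map, map_mul,
    Algebra.TensorProduct.map_tmul, map_one]
  rfl

end equivariance

/-! ### Compatibility of ψ with the Koszul differentials -/

section chainMap
variable {T V : Type*} [CommRing T] [Algebra ℂ T] [AddCommGroup V] [Module ℂ V]

/-- The map `Sym V ⊗ ⋀V → T ⊗ ⋀V` induced by an algebra map `f : Sym V → T`. -/
noncomputable def koszulExtend (f : SymmetricAlgebra ℂ V →ₐ[ℂ] T) :
    SymmetricAlgebra ℂ V ⊗[ℂ] ExteriorAlgebra ℂ V →ₐ[ℂ] T ⊗[ℂ] ExteriorAlgebra ℂ V :=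
  Algebra.TensorProduct.map f (AlgHom.id ℂ (ExteriorAlgebra ℂ V))

theorem koszulExtend_tmul (f : SymmetricAlgebra ℂ V →ₐ[ℂ] T) (s : SymmetricAlgebra ℂ V)
    (x : ExteriorAlgebra ℂ V) : koszulExtend f (s ⊗ₜ x) = f s ⊗ₜ x := rfl

/-- The antiderivation rule for the one-form attached to a: its contraction applies γ to the
exterior slot of a and f to the symmetric slot, then multiplies. -/
theorem koszul_koszulExtend_mul (f : SymmetricAlgebra ℂ V →ₐ[ℂ] T) (γ : V →ₗ[ℂ] T) (a : V ⊗[ℂ] V)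
    (z : T ⊗[ℂ] ExteriorAlgebra ℂ V) :
    koszul γ (koszulExtend f (tensorToKoszul V a) * z) =
      LinearMap.mul' ℂ T (TensorProduct.map γ (f.toLinearMap ∘ₗ SymmetricAlgebra.ι ℂ V) a) • z -
        koszulExtend f (tensorToKoszul V a) * koszul γ z := by
  induction a with
  | zero => simp
  | add a b ha hb => simp only [map_add, add_mul, add_smul, ha, hb]; abel
  | tmul v u =>
    have h : ∀ z : T ⊗[ℂ] ExteriorAlgebra ℂ V, koszulExtend f (tensorToKoszul V (v ⊗ₜ u)) * z =
        f (SymmetricAlgebra.ι ℂ V u) • ((1 ⊗ₜ ExteriorAlgebra.ι ℂ v) * z) := fun z => by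
      rw [← smul_mul_assoc, TensorProduct.smul_tmul', smul_eq_mul, mul_one, tensorToKoszul_tmul,
        koszulExtend_tmul]
    rw [h, h, map_smul, koszul_ι_mul, smul_sub, smul_smul, mul_comm (f _)]
    rfl

/-- The `T`-linear extension to `T ⊗ ⋀W` of the map `⋀W → Sym V ⊗ ⋀V` induced by
`θ : W → ⋀²V`, over an algebra map `f : Sym V → T`. -/
noncomputable def psiExtend {W : Type*} [AddCommGroup W] [Module ℂ W] (θ : W →ₗ[ℂ] ⋀[ℂ]^2 V)
    (f : SymmetricAlgebra ℂ V →ₐ[ℂ] T) :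
    T ⊗[ℂ] ExteriorAlgebra ℂ W →ₗ[T] T ⊗[ℂ] ExteriorAlgebra ℂ V :=
  LinearMap.liftBaseChange T ((koszulExtend f).comp ((koszulMul V).comp
    ((ExteriorAlgebra.map (wedgeIncl V)).comp (ExteriorAlgebra.map θ)))).toLinearMap

theorem psiExtend_tmul {W : Type*} [AddCommGroup W] [Module ℂ W] (θ : W →ₗ[ℂ] ⋀[ℂ]^2 V)
    (f : SymmetricAlgebra ℂ V →ₐ[ℂ] T) (t : T) (x : ExteriorAlgebra ℂ W) :
    psiExtend θ f (t ⊗ₜ x) = t • koszulExtend f (koszulMul V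
      (ExteriorAlgebra.map (wedgeIncl V) (ExteriorAlgebra.map θ x))) := rfl

theorem psiExtend_ι_mul {W : Type*} [AddCommGroup W] [Module ℂ W] (θ : W →ₗ[ℂ] ⋀[ℂ]^2 V)
    (f : SymmetricAlgebra ℂ V →ₐ[ℂ] T) (w : W) (y : T ⊗[ℂ] ExteriorAlgebra ℂ W) :
    psiExtend θ f ((1 ⊗ₜ ExteriorAlgebra.ι ℂ w) * y) =
      koszulExtend f (tensorToKoszul V (wedgeIncl V (θ w))) * psiExtend θ f y := by
  induction y with
  | zero => simp
  | add a b ha hb => simp only [map_add, mul_add, ha, hb]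
  | tmul t x =>
    rw [Algebra.TensorProduct.tmul_mul_tmul, one_mul, psiExtend_tmul, psiExtend_tmul,
      mul_smul_comm, map_mul, map_mul, map_mul, map_mul, ExteriorAlgebra.map_apply_ι,
      ExteriorAlgebra.map_apply_ι, koszulMul, ExteriorAlgebra.lift_ι_apply]

/-- Prepending a factor w changes both sides by the same rule, a scalar term minus multiplication by
the image of w; `hg` says precisely that the two scalars agree. -/
theorem koszul_psiExtend {W : Type*} [AddCommGroup W] [Module ℂ W] (θ : W →ₗ[ℂ] ⋀[ℂ]^2 V)
    (f : SymmetricAlgebra ℂ V →ₐ[ℂ] T) (γ : V →ₗ[ℂ] T) (g : W →ₗ[ℂ] T)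
    (hg : ∀ w, g w = LinearMap.mul' ℂ T (TensorProduct.map γ
      (f.toLinearMap ∘ₗ SymmetricAlgebra.ι ℂ V) (wedgeIncl V (θ w))))
    (y : T ⊗[ℂ] ExteriorAlgebra ℂ W) :
    psiExtend θ f (koszul g y) = koszul γ (psiExtend θ f y) := by
  have key : ∀ i (x : ExteriorAlgebra ℂ W), x ∈ ⋀[ℂ]^i W →
      psiExtend θ f (koszul g (1 ⊗ₜ x)) = koszul γ (psiExtend θ f (1 ⊗ₜ x)) := by
    refine fun i x hx => exteriorPower_induction (C := fun _ x =>
      psiExtend θ f (koszul g (1 ⊗ₜ x)) = koszul γ (psiExtend θ f (1 ⊗ₜ x))) ?_ ?_ ?_ ?_ i x hx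
    · rw [koszul_tmul_one, map_zero, psiExtend_tmul, map_one, map_one, map_one, map_one, map_smul,
        Algebra.TensorProduct.one_def, koszul_tmul_one, smul_zero]
    · intro _ x y hx hy
      simp only [TensorProduct.tmul_add, map_add, hx, hy]
    · intro _ c x hx
      rw [TensorProduct.tmul_smul, ← algebraMap_smul T c, map_smul, map_smul, map_smul, map_smul,
        hx]
    · intro _ w x _ hx
      have h : (1 : T) ⊗ₜ[ℂ] (ExteriorAlgebra.ι ℂ w * x) =
          (1 ⊗ₜ ExteriorAlgebra.ι ℂ w) * ((1 : T) ⊗ₜ[ℂ] x) := by simp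
      rw [h, koszul_ι_mul, map_sub, map_smul, psiExtend_ι_mul, hx, psiExtend_ι_mul,
        koszul_koszulExtend_mul, ← hg]
  induction y with
  | zero => simp
  | add a b ha hb => simp only [map_add, ha, hb]
  | tmul t x =>
    have h : (t ⊗ₜ[ℂ] x) = t • ((1 : T) ⊗ₜ[ℂ] x) := by simp [TensorProduct.smul_tmul']
    rw [h, map_smul, map_smul, map_smul, map_smul]
    congr 1
    -- `key` covers homogeneous x; the grading of the exterior algebra gives the rest.
    refine DirectSum.Decomposition.inductionOn (fun i : ℕ => ⋀[ℂ]^i W) ?_ ?_ ?_ x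
    · simp
    · exact fun {i} m => key i m m.2
    · intro a b ha hb
      simp only [TensorProduct.tmul_add, map_add, ha, hb]

end chainMap

/-! ### The chain map f(V₁) -/

section psi
variable {V : Type u} [AddCommGroup V] [Module ℂ V] (V₁ : Submodule ℂ (⋀[ℂ]^2 V))

/-- This is the hypothesis `hg` of `koszul_psiExtend` for the Koszul map φ: γ puts one vector in the
first symmetric factor (the coefficients S) and f puts the other in the second. -/
theorem schurForm_koszulPhiRestrict (w : V₁) :
    schurForm (koszulPhiRestrict V₁) w = LinearMap.mul' ℂ
      (SymmetricAlgebra ℂ V ⊗[ℂ] SymmetricAlgebra ℂ V)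
      (TensorProduct.map (coeffForm (SymmetricAlgebra.ι ℂ V))
        ((Algebra.TensorProduct.includeRight : SymmetricAlgebra ℂ V →ₐ[ℂ]
          SymmetricAlgebra ℂ V ⊗[ℂ] SymmetricAlgebra ℂ V).toLinearMap ∘ₗ
          SymmetricAlgebra.ι ℂ V) (wedgeIncl V (V₁.subtype w))) := by
  have h : schurForm (koszulPhiRestrict V₁) w = TensorProduct.map (SymmetricAlgebra.ι ℂ V)
      (SymmetricAlgebra.ι ℂ V) (wedgeIncl V w) := by
    simp only [schurForm, koszulPhiRestrict, koszulPhi, LinearMap.comp_apply,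
      LinearMap.restrictScalars_apply, TensorProduct.mk_apply, LinearMap.baseChange_tmul,
      LinearMap.liftBaseChange_tmul, one_smul, Submodule.subtype_apply]
    generalize wedgeIncl V w = a
    induction a with
    | zero => simp
    | add a b ha hb => simp only [map_add, ha, hb]
    | tmul u v => simp
  rw [h, Submodule.subtype_apply]
  generalize wedgeIncl V w = a
  induction a with
  | zero => simp
  | add a b ha hb => simp only [map_add, ha, hb]
  | tmul u v => simp [coeffForm]

theorem assoc_symm_tmul_smul (s p : SymmetricAlgebra ℂ V)
    (z : SymmetricAlgebra ℂ V ⊗[ℂ] ExteriorAlgebra ℂ V) :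
    (TensorProduct.AlgebraTensorModule.assoc ℂ ℂ (SymmetricAlgebra ℂ V) (SymmetricAlgebra ℂ V)
      (SymmetricAlgebra ℂ V) (ExteriorAlgebra ℂ V)).symm (s ⊗ₜ (p • z)) =
    (s ⊗ₜ[ℂ] p) • koszulExtend (Algebra.TensorProduct.includeRight : SymmetricAlgebra ℂ V →ₐ[ℂ]
          SymmetricAlgebra ℂ V ⊗[ℂ] SymmetricAlgebra ℂ V) z := by
  induction z with
  | zero => simp
  | add a b ha hb => simp only [map_add, smul_add, TensorProduct.tmul_add, ha, hb]
  | tmul q x =>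
    rw [koszulExtend_tmul, TensorProduct.smul_tmul', TensorProduct.smul_tmul', smul_eq_mul,
      smul_eq_mul, TensorProduct.AlgebraTensorModule.assoc_symm_tmul,
      Algebra.TensorProduct.includeRight_apply, Algebra.TensorProduct.tmul_mul_tmul, mul_one]

/-- Identifies the S-linear extension of ψ with the restriction of `psiExtend`, so the chain map
identity becomes `koszul_psiExtend`. -/
theorem resIncl_psi (n i : ℕ) (y : SchurTerm (SymmetricAlgebra ℂ V) V₁ V n i) :
    resIncl V _ n i ((psi V₁ n i).baseChange (SymmetricAlgebra ℂ V) y) =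
      psiExtend V₁.subtype Algebra.TensorProduct.includeRight (inclBase V₁ V _ i _ y) := by
  induction y using TensorProduct.induction_on with
  | zero => simp
  | add a b ha hb => simp only [map_add, ha, hb]
  | tmul s t =>
    induction t using TensorProduct.induction_on with
    | zero => simp
    | add a b ha hb => simp only [TensorProduct.tmul_add, map_add, ha, hb]
    | tmul x p =>
      have h : incl V V i n (psi V₁ n i (x ⊗ₜ p)) = (p : SymmetricAlgebra ℂ V) • koszulMul V
          (ExteriorAlgebra.map (wedgeIncl V) (ExteriorAlgebra.map V₁.subtype (x : ExteriorAlgebra ℂ V₁))) := by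
        rw [psi, LinearMap.comp_apply, LinearMap.rTensor_tmul, incl_psiFull,
          TensorProduct.map_tmul, Submodule.subtype_apply, Submodule.subtype_apply,
          psiAmbient_tmul', coe_exteriorPower_map]
      have h1 := congrArg (fun z => (TensorProduct.AlgebraTensorModule.assoc ℂ ℂ
        (SymmetricAlgebra ℂ V) (SymmetricAlgebra ℂ V) (SymmetricAlgebra ℂ V)
        (ExteriorAlgebra ℂ V)).symm (s ⊗ₜ z)) h
      exact h1.trans (assoc_symm_tmul_smul s p _)

theorem psi_schurD (n i : ℕ) (y : SchurTerm (SymmetricAlgebra ℂ V) V₁ V n (i + 1)) :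
    (psi V₁ n i).baseChange (SymmetricAlgebra ℂ V) (schurD (koszulPhiRestrict V₁) n i y) =
      resD (SymmetricAlgebra.ι ℂ V) n i
        ((psi V₁ n (i + 1)).baseChange (SymmetricAlgebra ℂ V) y) := by
  have h1 := resIncl_psi V₁ n i (schurD (koszulPhiRestrict V₁) n i y)
  have h2 := congrArg (psiExtend V₁.subtype (Algebra.TensorProduct.includeRight :
    SymmetricAlgebra ℂ V →ₐ[ℂ] SymmetricAlgebra ℂ V ⊗[ℂ] SymmetricAlgebra ℂ V))
    (inclBase_schurD (koszulPhiRestrict V₁) n i y)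
  have h3 := koszul_psiExtend V₁.subtype (Algebra.TensorProduct.includeRight :
    SymmetricAlgebra ℂ V →ₐ[ℂ] SymmetricAlgebra ℂ V ⊗[ℂ] SymmetricAlgebra ℂ V)
    (coeffForm (SymmetricAlgebra.ι ℂ V)) (schurForm (koszulPhiRestrict V₁))
    (schurForm_koszulPhiRestrict V₁) (inclBase V₁ V (SymmetricAlgebra ℂ V) (i + 1) _ y)
  have h4 := congrArg (koszul (coeffForm (SymmetricAlgebra.ι ℂ V))) (resIncl_psi V₁ n (i + 1) y)
  have h5 := resIncl_resD (SymmetricAlgebra.ι ℂ V) n i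
    ((psi V₁ n (i + 1)).baseChange (SymmetricAlgebra ℂ V) y)
  exact resIncl_injective V _ n i (h1.trans (h2.trans (h3.trans (h4.symm.trans h5.symm))))

open CategoryTheory in
theorem exists_chainComplex_of_hom {C : Type*} [Category C] [Limits.HasZeroMorphisms C]
    {X Y : ℕ → C} (dX : ∀ n, X (n + 1) ⟶ X n) (dY : ∀ n, Y (n + 1) ⟶ Y n)
    (hX : ∀ n, dX (n + 1) ≫ dX n = 0) (hY : ∀ n, dY (n + 1) ≫ dY n = 0) (f : ∀ n, X n ⟶ Y n)
    (hf : ∀ n, f (n + 1) ≫ dY n = dX n ≫ f n) :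
    ∃ F : ChainComplex.of X dX hX ⟶ ChainComplex.of Y dY hY, ∀ n, F.f n = f n :=
  ⟨ChainComplex.ofHom f fun n => by
    change f (n + 1) ≫ ChainComplex.of.d Y dY (n + 1) n =
      ChainComplex.of.d X dX (n + 1) n ≫ f n
    rw [ChainComplex.of_d, ChainComplex.of_d, hf], fun _ => rfl⟩

/-- The component of degree `i` of the chain map `f(V₁)`. -/
noncomputable def psiHom (n i : ℕ) :
    ModuleCat.of (SymmetricAlgebra ℂ V) (SchurTerm (SymmetricAlgebra ℂ V) V₁ V n i) ⟶
      ModuleCat.of (SymmetricAlgebra ℂ V) (ResTerm V (SymmetricAlgebra ℂ V) n i) :=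
  ModuleCat.ofHom ((psi V₁ n i).baseChange (SymmetricAlgebra ℂ V))

open CategoryTheory in
theorem psiHom_comp (n i : ℕ) :
    psiHom V₁ n (i + 1) ≫ ModuleCat.ofHom (resD (SymmetricAlgebra.ι ℂ V) n i) =
      ModuleCat.ofHom (schurD (koszulPhiRestrict V₁) n i) ≫ psiHom V₁ n i := by
  apply ModuleCat.hom_ext
  exact LinearMap.ext fun y => (psi_schurD V₁ n i y).symm

open CategoryTheory in
theorem ofHom_schurD_comp {S W V : Type u} [CommRing S] [Algebra ℂ S] [AddCommGroup W] [Module ℂ W]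
    [AddCommGroup V] [Module ℂ V] (φ : S ⊗[ℂ] W →ₗ[S] S ⊗[ℂ] V) (k i : ℕ) :
    ModuleCat.ofHom (schurD φ k (i + 1)) ≫ ModuleCat.ofHom (schurD φ k i) = 0 := by
  rw [← ModuleCat.ofHom_comp, schurD_schurD]
  rfl

open CategoryTheory in
variable (V) in
theorem ofHom_resD_comp (n i : ℕ) : ModuleCat.ofHom (resD (SymmetricAlgebra.ι ℂ V) n (i + 1)) ≫
    ModuleCat.ofHom (resD (SymmetricAlgebra.ι ℂ V) n i) = 0 := by
  rw [← ModuleCat.ofHom_comp, resD_resD]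
  rfl

theorem exists_schurComplex_hom (n : ℕ) :
    ∃ f : schurComplex (koszulPhiRestrict V₁) n ⟶ resComplex V n,
      ∀ i : ℕ, f.f i = psiHom V₁ n i := by
  have h₁ := ofHom_schurD_comp (S := SymmetricAlgebra ℂ V) (W := V₁) (V := V)
    (koszulPhiRestrict V₁) n
  have h₂ := ofHom_resD_comp V n
  have h := exists_chainComplex_of_hom _ _ h₁ h₂ (psiHom V₁ n) (psiHom_comp V₁ n)
  exact h

end psi

end HookResolution

theorem mainTheorem5 (b : ℕ) (hb : 1 ≤ b) (V : Type*) [AddCommGroup V] [Module ℂ V]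
    [FiniteDimensional ℂ V] (hV : Module.finrank ℂ V = b + 1) :
    (IsMinimalFreeResolution (irrelevant V) (irrelevant V ^ (b - 1)) (resComplex V (b - 1))
        (resAug V (b - 1)) ∧
      (∀ (g : V ≃ₗ[ℂ] V) (x : ResTerm V (SymmetricAlgebra ℂ V) (b - 1) 0),
        resAug V (b - 1) (resAct g (b - 1) 0 x) = symMap g (resAug V (b - 1) x)) ∧
      (∀ (g : V ≃ₗ[ℂ] V) (i : ℕ) (x : ResTerm V (SymmetricAlgebra ℂ V) (b - 1) (i + 1)),
        resD (SymmetricAlgebra.ι ℂ V) (b - 1) i (resAct g (b - 1) (i + 1) x) =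
          resAct g (b - 1) i (resD (SymmetricAlgebra.ι ℂ V) (b - 1) i x))) ∧
    (∀ i ≤ b - 1, Function.Surjective (psiFull V (b - 1) i) ∧
      ∀ g : V ≃ₗ[ℂ] V,
        psiFull V (b - 1) i ∘ₗ TensorProduct.map
            (exteriorPower.map i (exteriorPower.map 2 g.toLinearMap)) (symPowMap g _) =
          hookMap g (b - 1) i ∘ₗ psiFull V (b - 1) i) ∧
    ∀ V₁ : Submodule ℂ (⋀[ℂ]^2 V),
      ∃ f : schurComplex (koszulPhiRestrict V₁) (b - 1) ⟶ resComplex V (b - 1),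
        ∀ i : ℕ, f.f i =
          ModuleCat.ofHom ((psi V₁ (b - 1) i).baseChange (SymmetricAlgebra ℂ V)) := by
  refine ⟨⟨isMinimalFreeResolution_resComplex (b - 1), fun g x => resAug_resAct g (b - 1) x,
    fun g i x => resD_resAct g (b - 1) i x⟩,
    fun i hi => ⟨psiFull_surjective (b - 1) i hi, fun g => psiFull_map g (b - 1) i⟩, fun V₁ => ?_⟩
  obtain ⟨f, hf⟩ := exists_schurComplex_hom V₁ (b - 1)
  exact ⟨f, hf⟩
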